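/- Consider a finite episodic two-player zero-sum imperfect information game of length $H$ with perfect recall: a finite state space partitioned into information sets $\mathcal X$ of the max-player and $\mathcal Y$ of the min-player; finite non-empty action sets $\mathcal A(x)$, $\mathcal B(y)$; an initial state distribution, transition kernels $p_h(\cdot\mid s,a,b)$ and rewards $r_h(s,a,b)\in[0,1]$. Perfect recall means that every information set $x$ has a unique depth $h\in\{1,\dots,H\}$ and a unique history $(x_1,a_1,\dots,x_h)$ with $x_h=x$ (similarly for $y$). Let $A_{\mathcal X}=\sum_x|\mathcal A(x)|$, $B_{\mathcal Y}=\sum_y|\mathcal B(y)|$. A policy $\mu$ gives a distribution $\mu_h(\cdot\mid x_h)$ on $\mathcal A(x_h)$ for each information set; its realization plan is $\mu_{1:h}(x_h,a_h)=\prod_{h'\le h}\mu_{h'}(a_{h'}\mid x_{h'})$ along the history. $V^{\mu,\nu}$ is the expected sum of rewards in an episode, and $(\mu,\nu)$ is $\epsilon$-optimal if $\max_{\mu'}V^{\mu',\nu}-\min_{\nu'}V^{\mu,\nu'}\le\epsilon$. Balanced-FTRL for the max-player. Let $A^\tau(x)$ be the number of actions in the sub-tree of information sets starting at $x$ (including those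 at $x$). Let $p^\star_{1:h}(x_h)$ be the product along the history of $x_h$ of the balanced transitions $p^\star_0(x_1)=A^\tau(x_1)/A_{\mathcal X}$ and $p^\star_{h'}(x_{h'+1}\mid x_{h'},a_{h'})=A^\tau(x_{h'+1})/\sum_{x'}A^\tau(x')$, where $x'$ ranges over the information sets that directly follow $(x_{h'},a_{h'})$. In episode $t=1,\dots,T$ the player uses $$\mu^t\in\operatorname{argmin}_\mu\ \sum_{h}\sum_{(x_h,a_h)}\mu_{1:h}(x_h,a_h)\sum_{k<t}\tilde\ell^k_h(x_h,a_h)+\sum_{h=1}^H\frac1{\eta_h}\Psi_h\big(p^\star_{1:h}\cdot\mu_{1:h}\big),$$ where $\Psi_h(w)=\sum w\log w$ (Shannon) or $\Psi_h(w)=-\sum w^q$ with $q\in(0,1)$ (Tsallis), the sums being over pairs $(x_h,a_h)$ of depth $h$. It observes only its own trajectory $(x^t_h,a^t_h,r^t_h)_{h\le H}$ and sets $$\tilde\ell^t_h(x_h,a_h)=\frac{\mathbf 1\{x^t_h=x_h,a^t_h=a_h\}\,(1-r^t_h)}{\mu^t_{1:h}(x_h,a_h)+\gamma_h/p^\star_{1:h}(x_h)}.$$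 The parameters are, for all $h$, $\gamma_h=\sqrt{H\iota/(2A_{\mathcal X}T)}$ with $\iota=\log(3A_{\mathcal X}/\delta)$, and $\eta_h=\sqrt{2H\log(A_{\mathcal X})/(A_{\mathcal X}T)}$ for Shannon, $\eta_h=\sqrt{2q(1-q)/T}\,(H/A_{\mathcal X})^{q-1/2}$ for Tsallis. The min-player does the same on its own tree, with $\mathcal Y$, $B_{\mathcal Y}$ in place of $\mathcal X$, $A_{\mathcal X}$ and with $r^t_h$ in place of $1-r^t_h$. Each player may use either regularizer. Claim. There is a constant $C>0$, depending only on the chosen regularizers (hence absolute for Shannon, and depending only on $q$ for Tsallis), such that for every such game, all $\epsilon>0$, $\delta\in(0,1)$, and every number of episodes $$T\ \ge\ C\,\frac{H\,(A_{\mathcal X}+B_{\mathcal Y})\,\log(1/\delta+A_{\mathcal X}+B_{\mathcal Y})}{\epsilon^2},$$ if both players run Balanced-FTRL with these parameters for $T$ episodes, then with probability at least $1-\delta$ there are time-averaged policies, i.e. policies $\overline\mu$, $\overline\nu$ with $\overline\mu_{1:}=\frac1T\sum_{t=1}^T\mu^t_{1:}$ and $\overline\nu_{1:}=\frac1T\sum_{t=1}^T\nu^t_{1:}$,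 and every such profile $(\overline\mu,\overline\nu)$ is $\epsilon$-optimal. -/

import Mathlib

universe u

/-! ## The tree of information sets of one player -/

/-- The information sets of one player under perfect recall, for a game of length `H`. Every
information set `x` has a unique depth and a unique history: either `x` is at the first depth
(depth `0` of `Fin H`) and `parent x = none`, or `parent x = some ⟨x', a⟩`, where `x'` is the
preceding information set and `a` the action the player executed there. -/
structure InfoTree (H : ℕ) where
  /-- information sets -/
  Info : Type u
  /-- actions available at each information set -/
  Act : Info → Type u
  fintypeInfo : Fintype Info
  fintypeAct : ∀ x, Fintype (Act x)
  nonemptyAct : ∀ x, Nonempty (Act x)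
  depth : Info → Fin H
  parent : Info → Option (Σ x, Act x)
  parent_eq_none_iff : ∀ x, parent x = none ↔ (depth x : ℕ) = 0
  depth_of_parent : ∀ (x : Info) (q : Σ x, Act x),
    parent x = some q → (depth x : ℕ) = (depth q.1 : ℕ) + 1

attribute [instance] InfoTree.fintypeInfo InfoTree.fintypeAct InfoTree.nonemptyAct

namespace InfoTree

variable {H : ℕ} (I : InfoTree.{u} H)

/-- Pairs (information set, action). -/
abbrev Pair : Type u := Σ x : I.Info, I.Act x

/-- Total number of actions `∑ₓ |A(x)|`. -/
def totalActions : ℕ := ∑ x : I.Info, Fintype.card (I.Act x)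

/-- A (behavioural) policy: a probability distribution on the actions of each information set. -/
structure Policy where
  prob : ∀ x : I.Info, I.Act x → ℝ
  prob_nonneg : ∀ x a, 0 ≤ prob x a
  sum_prob : ∀ x, ∑ a, prob x a = 1

variable {I} in
/-- The realization plan `μ_{1:h}(x_h, a_h) = ∏_{h' ≤ h} μ_{h'}(a_{h'} | x_{h'})`, the product being
taken along the unique history `(x_1, a_1, …, x_h, a_h)`. -/
noncomputable def Policy.plan (μ : I.Policy) (q : I.Pair) : ℝ :=
  (match _h : I.parent q.1 with
    | none => 1
    | some q' => Policy.plan μ q') * μ.prob q.1 q.2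
termination_by (I.depth q.1 : ℕ)
decreasing_by
  have := I.depth_of_parent _ _ _h
  omega

/-- `x` is part of the history that leads to `x'` (possibly `x = x'`). -/
def Precedes : I.Info → I.Info → Prop :=
  Relation.ReflTransGen fun x x' => ∃ a : I.Act x, I.parent x' = some ⟨x, a⟩

open Classical in
/-- Number of actions in the whole sub-tree that starts at the information set `x`. -/
noncomputable def subtreeActions (x : I.Info) : ℕ :=
  ∑ x' : I.Info with I.Precedes x x', Fintype.card (I.Act x')

open Classical in
/-- The balanced transition probability of arriving at `x` from its predecessor: it is proportional
to `subtreeActions x` among all the information sets that share the predecessor of `x`. -/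
noncomputable def balancedStep (x : I.Info) : ℝ :=
  (I.subtreeActions x : ℝ) /
    (match I.parent x with
      | none => (I.totalActions : ℝ)
      | some q => ∑ x' : I.Info with I.parent x' = some q, (I.subtreeActions x' : ℝ))

/-- `p⋆_{1:h}(x)`, the product of the balanced transition probabilities along the history of `x`. -/
noncomputable def balanced (x : I.Info) : ℝ :=
  (match _h : I.parent x with
    | none => 1
    | some q => balanced q.1) * I.balancedStep x
termination_by (I.depth x : ℕ)
decreasing_by
  have := I.depth_of_parent _ _ _h
  omega

/-! ## Balanced FTRL -/

/-- What a player observes in one episode: at each step the information set, the action it executed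
there, and the loss it incurred. The loss is `1 - r` for the max-player and `r` for the
min-player, where `r` is the reward of the max-player. -/
abbrev Obs : Type u := Fin H → I.Pair × ℝ

/-- A learning rule: the policy that is played in the next episode, as a function of what the player
itself has observed in the `t` episodes that are already finished. -/
abbrev Learner : Type u := ∀ t : ℕ, (Fin t → I.Obs) → I.Policy

variable {I} in
open Classical in
/-- The implicit-exploration loss estimate after one episode, in which the policy `μ` was played and
`o` was observed, with IX parameters `γ⋆_h(x) = γ_h / p⋆_{1:h}(x)`. -/
noncomputable def ixLoss (γ : Fin H → ℝ) (μ : I.Policy) (o : I.Obs) (q : I.Pair) : ℝ :=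
  if (o (I.depth q.1)).1 = q then
    (o (I.depth q.1)).2 / (μ.plan q + γ (I.depth q.1) / I.balanced q.1)
  else 0

variable {I} in
/-- The cumulative loss estimate of a learner after `t` episodes. -/
noncomputable def cumLoss (γ : Fin H → ℝ) (L : I.Learner) {t : ℕ} (o : Fin t → I.Obs)
    (q : I.Pair) : ℝ :=
  ∑ k : Fin t, ixLoss γ (L k fun i => o (Fin.castLE k.isLt.le i)) (o k) q

end InfoTree

/-- The regularizers: Shannon entropy, or Tsallis entropy with parameter in `(0,1)`. -/
inductive Entropy where
  | shannon : Entropy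
  | tsallis : Set.Ioo (0 : ℝ) 1 → Entropy

namespace Entropy

/-- The contribution of one coordinate `w` to the regularizer: `w log w` or `-w ^ q`. -/
noncomputable def term : Entropy → ℝ → ℝ
  | shannon, w => w * Real.log w
  | tsallis q, w => -w ^ (q : ℝ)

/-- The learning rate, for total number of actions `A`, game length `H` and `T` episodes:
`√(2 H log A / (A T))` for Shannon and `√(2 q (1-q) / T) (H / A)^(q - 1/2)` for Tsallis. -/
noncomputable def rate (R : Entropy) (A H T : ℕ) : ℝ :=
  match R with
  | shannon => √(2 * (H : ℝ) * Real.log A / ((A : ℝ) * T))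
  | tsallis q => √(2 * (q : ℝ) * (1 - q) / T) * ((H : ℝ) / A) ^ ((q : ℝ) - 1 / 2)

end Entropy

/-- The IX parameter `√(H ι / (2 A T))` with `ι = log (3 A / δ)`. -/
noncomputable def ixParameter (A H T : ℕ) (δ : ℝ) : ℝ :=
  √((H : ℝ) * Real.log (3 * A / δ) / (2 * A * T))

namespace InfoTree

variable {H : ℕ} {I : InfoTree.{u} H}

open Classical in
/-- The regularizer `Ψ_h (p⋆_{1:h} · μ_{1:h})` at depth `h`. -/
noncomputable def regularizer (R : Entropy) (μ : I.Policy) (h : Fin H) : ℝ :=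
  ∑ q : I.Pair with I.depth q.1 = h, R.term (I.balanced q.1 * μ.plan q)

/-- The objective `⟨μ_{1:}, L⟩ + ∑_h Ψ_h (p⋆_{1:h} · μ_{1:h}) / η_h`. -/
noncomputable def objective (R : Entropy) (η : Fin H → ℝ) (L : I.Pair → ℝ) (μ : I.Policy) : ℝ :=
  ∑ q : I.Pair, μ.plan q * L q + ∑ h : Fin H, regularizer R μ h / η h

/-- Balanced FTRL over `T` episodes with regularizer `R`, learning rates `η` and IX parameters `γ`:
in each episode the policy minimizes the objective for the cumulative estimated loss. -/
def Learner.IsBalancedFTRL (L : I.Learner) (R : Entropy) (η γ : Fin H → ℝ) (T : ℕ) : Prop :=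
  ∀ t < T, ∀ (o : Fin t → I.Obs) (μ : I.Policy),
    objective R η (cumLoss γ L o) (L t o) ≤ objective R η (cumLoss γ L o) μ

/-- Balanced FTRL with the tuned constant parameters, for `T` episodes and confidence `δ`. -/
def Learner.IsTunedBalancedFTRL (L : I.Learner) (R : Entropy) (T : ℕ) (δ : ℝ) : Prop :=
  L.IsBalancedFTRL R (fun _ => R.rate I.totalActions H T)
    (fun _ => ixParameter I.totalActions H T δ) T

end InfoTree

/-! ## The game -/

/-- A finite episodic two-player zero-sum imperfect information game of length `H` with perfect
recall. `X` and `Y` are the information set trees of the max- and min-player; `infoX` and `infoY`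
are the partitions of the states into information sets. As the information set of a state
determines the step at which it occurs, the step index of transitions and rewards is carried by
the state. Transitions out of states of the last step are never used. Perfect recall is the
compatibility of the dynamics with the two trees. -/
structure Game (H : ℕ) where
  State : Type u
  fintypeState : Fintype State
  X : InfoTree.{u} H
  Y : InfoTree.{u} H
  infoX : State → X.Info
  infoY : State → Y.Info
  infoX_surjective : Function.Surjective infoX
  infoY_surjective : Function.Surjective infoY
  depth_eq : ∀ s, X.depth (infoX s) = Y.depth (infoY s)
  /-- distribution of the initial state -/
  init : State → ℝ
  init_nonneg : ∀ s, 0 ≤ init s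
  sum_init : ∑ s, init s = 1
  init_depth : ∀ s, init s ≠ 0 → (X.depth (infoX s) : ℕ) = 0
  /-- `trans s a b s'` is the probability of moving from `s` to `s'` under the actions `a`, `b` -/
  trans : ∀ s, X.Act (infoX s) → Y.Act (infoY s) → State → ℝ
  trans_nonneg : ∀ s a b s', 0 ≤ trans s a b s'
  sum_trans : ∀ s a b, (X.depth (infoX s) : ℕ) + 1 < H → ∑ s', trans s a b s' = 1
  recallX : ∀ s a b s', (X.depth (infoX s) : ℕ) + 1 < H → trans s a b s' ≠ 0 →
    X.parent (infoX s') = some ⟨infoX s, a⟩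
  recallY : ∀ s a b s', (X.depth (infoX s) : ℕ) + 1 < H → trans s a b s' ≠ 0 →
    Y.parent (infoY s') = some ⟨infoY s, b⟩
  /-- reward of the max-player -/
  reward : ∀ s, X.Act (infoX s) → Y.Act (infoY s) → ℝ
  reward_nonneg : ∀ s a b, 0 ≤ reward s a b
  reward_le_one : ∀ s a b, reward s a b ≤ 1

attribute [instance] Game.fintypeState

namespace Game

variable {H : ℕ} (G : Game.{u} H)

/-- One step of an episode: the state and the actions of the two players. -/
abbrev Step : Type u := Σ s : G.State, G.X.Act (G.infoX s) × G.Y.Act (G.infoY s)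

/-- The course of an episode. -/
abbrev Episode : Type u := Fin H → G.Step

variable {G}

/-- The max-player's pair (information set, action) at a step. -/
def Step.pairX (z : G.Step) : G.X.Pair := ⟨G.infoX z.1, z.2.1⟩

/-- The min-player's pair (information set, action) at a step. -/
def Step.pairY (z : G.Step) : G.Y.Pair := ⟨G.infoY z.1, z.2.2⟩

/-- The reward at a step. -/
def Step.rew (z : G.Step) : ℝ := G.reward z.1 z.2.1 z.2.2

/-- Conditional probability of the state at step `h` of the episode `e`, given the previous step. -/
def arrivalProb (e : G.Episode) (h : Fin H) : ℝ :=
  if (h : ℕ) = 0 then G.init (e h).1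
  else
    let z := e ⟨(h : ℕ) - 1, (Nat.sub_le _ _).trans_lt h.isLt⟩
    G.trans z.1 z.2.1 z.2.2 (e h).1

/-- Probability of the episode `e` when the players use the policies `μ` and `ν`. -/
def episodeProb (μ : G.X.Policy) (ν : G.Y.Policy) (e : G.Episode) : ℝ :=
  ∏ h : Fin H, arrivalProb e h *
    (μ.prob (G.infoX (e h).1) (e h).2.1 * ν.prob (G.infoY (e h).1) (e h).2.2)

/-- The expected total reward `V^{μ,ν}` of the max-player. -/
noncomputable def value (μ : G.X.Policy) (ν : G.Y.Policy) : ℝ :=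
  ∑ e : G.Episode, episodeProb μ ν e * ∑ h : Fin H, (e h).rew

/-- `(μ, ν)` is an `ε`-optimal profile: `max_{μ'} V^{μ',ν} - min_{ν'} V^{μ,ν'} ≤ ε`. -/
def IsEpsOptimal (ε : ℝ) (μ : G.X.Policy) (ν : G.Y.Policy) : Prop :=
  ∀ (μ' : G.X.Policy) (ν' : G.Y.Policy), value μ' ν - value μ ν' ≤ ε

/-- What the max-player observes in an episode. -/
def obsX (e : G.Episode) : G.X.Obs := fun h => ((e h).pairX, 1 - (e h).rew)

/-- What the min-player observes in an episode. -/
def obsY (e : G.Episode) : G.Y.Obs := fun h => ((e h).pairY, (e h).rew)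

variable {T : ℕ}

/-- The policy `μ^t` of the max-player in the run `ω` of `T` episodes. -/
def policyX (LX : G.X.Learner) (ω : Fin T → G.Episode) (t : Fin T) : G.X.Policy :=
  LX t fun i => obsX (ω (Fin.castLE t.isLt.le i))

/-- The policy `ν^t` of the min-player in the run `ω` of `T` episodes. -/
def policyY (LY : G.Y.Learner) (ω : Fin T → G.Episode) (t : Fin T) : G.Y.Policy :=
  LY t fun i => obsY (ω (Fin.castLE t.isLt.le i))

/-- Probability of the run `ω` of `T` episodes when the players learn with `LX` and `LY`. -/
def runProb (LX : G.X.Learner) (LY : G.Y.Learner) (ω : Fin T → G.Episode) : ℝ :=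
  ∏ t : Fin T, episodeProb (policyX LX ω t) (policyY LY ω t) (ω t)

/-- Probability of an event that depends on the run of `T` episodes. -/
noncomputable def eventProb (LX : G.X.Learner) (LY : G.Y.Learner)
    (E : Set (Fin T → G.Episode)) : ℝ :=
  ∑ ω : Fin T → G.Episode, E.indicator (runProb LX LY) ω

end Game

/-- `μbar` is a time average of the policies `μ t`: its realization plan is the average of theirs. -/
def InfoTree.IsTimeAverage {H : ℕ} {I : InfoTree.{u} H} {T : ℕ} (μ : Fin T → I.Policy)
    (μbar : I.Policy) : Prop :=
  ∀ q : I.Pair, μbar.plan q = (∑ t : Fin T, (μ t).plan q) / T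

/-! The value is bilinear in the realization plans, so the gap of a time-averaged profile is exactly
the average of the two players' regrets for their counterfactual losses (`Game.gap_eq_sum_regret`).
It remains to bound the regret of one player by `K √(H A T ι)` outside an event of probability `δ /
2` (`InfoTree.exists_regret_constant`). There the opponent enters only through `IsFeedback`, so it
may adapt to the past, and one theorem serves both players.

The balanced weights p⋆ have two dual properties. Paired with any realization plan they sum to at
most `1` at each depth (`sum_balanced_mul_plan_le`), hence to at most `H` in total. Dividing any
flow by them gives a sum of at most `A` (`IsFlow.sum_div_balanced_le`), by telescoping over sub-tree
sizes. The first property bounds the range of the regularizer and the error on the competitor's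
loss; the second bounds the bias of the estimates, and both together bound the stability term.

The regret splits into the error on the player's own loss, the regret on the estimated losses, and
the error on the competitor's loss. For the middle part the regularizer is separable over pairs, so
no recursion over the tree is needed: the stability estimate is the scalar inequality
`Entropy.stability`, combined with first-order optimality of the minimizer (`objective_min_step`,
`ftrl_regret_le`). It is linear in the loss estimate because the plan times the estimate is at most
`1`. All random deviations are controlled by exponential supermartingales that the
implicit-exploration bias makes available (`sum_prob_mul_exp_upper_le`,
`sum_prob_mul_exp_lower_le`), followed by Markov's inequality and a union bound over `A + 2H ≤ 3A`
events. -/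

namespace InfoTree

variable {H : ℕ} {I : InfoTree.{u} H}

/-! ### Realization plans and their convexity -/

/-- The probability that the player's own actions lead to `x`: the realization plan of the
predecessor of `x`, or `1` at the first depth. -/
noncomputable def Policy.reach (μ : I.Policy) (x : I.Info) : ℝ :=
  (I.parent x).elim 1 μ.plan

theorem Policy.plan_eq (μ : I.Policy) (q : I.Pair) :
    μ.plan q = μ.reach q.1 * μ.prob q.1 q.2 := by
  rw [Policy.plan, Policy.reach]
  split <;> rename_i h <;> simp [h]

theorem balanced_eq (x : I.Info) :
    I.balanced x = (I.parent x).elim 1 (fun q => I.balanced q.1) * I.balancedStep x := by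
  rw [balanced]
  split <;> rename_i h <;> simp [h]

/-- Induction along the depth of information sets. -/
theorem info_induction {p : I.Info → Prop}
    (h : ∀ x, (∀ q, I.parent x = some q → p q.1) → p x) (x : I.Info) : p x := by
  induction hn : (I.depth x : ℕ) using Nat.strong_induction_on generalizing x with
  | _ n ih =>
    refine h x fun q hq => ih _ ?_ q.1 rfl
    have := I.depth_of_parent x q hq
    omega

theorem Policy.reach_of_none (μ : I.Policy) {x : I.Info} (h : I.parent x = none) :
    μ.reach x = 1 := by simp [reach, h]

theorem Policy.reach_of_some (μ : I.Policy) {x : I.Info} {q : I.Pair} (h : I.parent x = some q) :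
    μ.reach x = μ.plan q := by simp [reach, h]

theorem Policy.reach_nonneg (μ : I.Policy) (x : I.Info) : 0 ≤ μ.reach x := by
  induction x using info_induction with
  | h x ih =>
    cases hp : I.parent x with
    | none => simp [μ.reach_of_none hp]
    | some q =>
      rw [μ.reach_of_some hp, μ.plan_eq]
      exact mul_nonneg (ih q hp) (μ.prob_nonneg _ _)

theorem Policy.plan_nonneg (μ : I.Policy) (q : I.Pair) : 0 ≤ μ.plan q := by
  rw [μ.plan_eq]
  exact mul_nonneg (μ.reach_nonneg _) (μ.prob_nonneg _ _)

theorem Policy.sum_plan (μ : I.Policy) (x : I.Info) : ∑ a, μ.plan ⟨x, a⟩ = μ.reach x := by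
  simp [μ.plan_eq, ← Finset.mul_sum, μ.sum_prob]

/-- The policy that plays uniformly. -/
noncomputable def uniformPolicy (I : InfoTree.{u} H) : I.Policy where
  prob x _ := (Fintype.card (I.Act x) : ℝ)⁻¹
  prob_nonneg _ _ := by positivity
  sum_prob x := by simp

theorem uniformPolicy_plan_pos (q : I.Pair) : 0 < I.uniformPolicy.plan q := by
  have hr : ∀ x, 0 < I.uniformPolicy.reach x := by
    intro x
    induction x using info_induction with
    | h x ih =>
      cases hp : I.parent x with
      | none => simp [Policy.reach_of_none _ hp]
      | some q =>
        rw [Policy.reach_of_some _ hp, Policy.plan_eq]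
        exact mul_pos (ih q hp) (inv_pos.2 (by exact_mod_cast Fintype.card_pos))
  rw [Policy.plan_eq]
  exact mul_pos (hr _) (inv_pos.2 (by exact_mod_cast Fintype.card_pos))

/-- A nonnegative function that satisfies the flow equations is a realization plan. -/
theorem exists_policy_plan_eq (v : I.Pair → ℝ) (hv : ∀ q, 0 ≤ v q)
    (hsum : ∀ x, ∑ a, v ⟨x, a⟩ = (I.parent x).elim 1 v) :
    ∃ μ : I.Policy, ∀ q, μ.plan q = v q := by
  classical
  let μ : I.Policy :=
    -- Where the inflow vanishes, normalizing is impossible and any distribution will do; the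
    -- uniform one is taken.
    { prob := fun x a => if (I.parent x).elim 1 v = 0 then (Fintype.card (I.Act x) : ℝ)⁻¹
        else v ⟨x, a⟩ / (I.parent x).elim 1 v
      prob_nonneg := by
        intro x a
        split_ifs
        · positivity
        · rw [← hsum]
          exact div_nonneg (hv _) (Finset.sum_nonneg fun _ _ => hv _)
      sum_prob := by
        intro x
        split_ifs with h
        · simp
        · rw [← Finset.sum_div, hsum, div_self h] }
  have key : ∀ x, μ.reach x = (I.parent x).elim 1 v := by
    intro x
    induction x using info_induction with
    | h x ih =>
      cases hp : I.parent x with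
      | none => simp [Policy.reach_of_none _ hp]
      | some q =>
        rw [Policy.reach_of_some _ hp, Policy.plan_eq, ih q hp]
        simp only [μ, Option.elim_some]
        split_ifs with h
        -- No mass flows into `q.1`, so `v q` is a nonnegative term of a zero sum.
        · rw [h, zero_mul]
          refine (le_antisymm ?_ (hv q)).symm
          rw [← h, ← hsum]
          exact Finset.single_le_sum (f := fun a => v ⟨q.1, a⟩) (fun _ _ => hv _)
            (Finset.mem_univ q.2)
        · rw [mul_div_cancel₀ _ h]
  refine ⟨μ, fun q => ?_⟩
  rw [Policy.plan_eq, key]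
  simp only [μ]
  split_ifs with h
  · rw [h, zero_mul]
    refine (le_antisymm ?_ (hv q)).symm
    rw [← h, ← hsum]
    exact Finset.single_le_sum (f := fun a => v ⟨q.1, a⟩) (fun _ _ => hv _) (Finset.mem_univ q.2)
  · rw [mul_div_cancel₀ _ h]

/-- Realization plans are closed under convex combinations. -/
theorem exists_policy_plan_eq_sum {ι : Type*} [Fintype ι] (w : ι → ℝ) (hw : ∀ i, 0 ≤ w i)
    (hw1 : ∑ i, w i = 1) (μ : ι → I.Policy) :
    ∃ ν : I.Policy, ∀ q, ν.plan q = ∑ i, w i * (μ i).plan q := by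
  refine exists_policy_plan_eq _
    (fun q => Finset.sum_nonneg fun i _ => mul_nonneg (hw i) ((μ i).plan_nonneg q)) fun x => ?_
  rw [Finset.sum_comm]
  simp only [← Finset.mul_sum, Policy.sum_plan]
  cases hp : I.parent x with
  | none => simp [Policy.reach_of_none _ hp, hw1]
  | some q => simp [Policy.reach_of_some _ hp]

theorem exists_isTimeAverage {T : ℕ} (hT : 0 < T) (μ : Fin T → I.Policy) :
    ∃ μbar, IsTimeAverage μ μbar := by
  have hT' : (T : ℝ) ≠ 0 := by positivity
  obtain ⟨ν, hν⟩ := exists_policy_plan_eq_sum (fun _ : Fin T => (T : ℝ)⁻¹)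
    (fun _ => by positivity) (by simp [hT']) μ
  refine ⟨ν, fun q => ?_⟩
  rw [hν, ← Finset.mul_sum, div_eq_inv_mul]

/-! ### Sub-tree sizes, balanced transitions and flows -/

theorem Precedes.refl (x : I.Info) : I.Precedes x x := Relation.ReflTransGen.refl

theorem Precedes.depth_le {x x' : I.Info} (h : I.Precedes x x') :
    (I.depth x : ℕ) ≤ I.depth x' := by
  induction h with
  | refl => rfl
  | tail _ h ih =>
    obtain ⟨a, ha⟩ := h
    have := I.depth_of_parent _ _ ha
    simp only at this
    omega

theorem Precedes.eq_of_depth_le {x x' : I.Info} (h : I.Precedes x x')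
    (hd : (I.depth x' : ℕ) ≤ I.depth x) : x = x' := by
  rcases Relation.ReflTransGen.cases_tail h with h | ⟨y, hy, a, ha⟩
  · exact h.symm
  · have h1 := Precedes.depth_le hy
    have h2 := I.depth_of_parent _ _ ha
    simp only at h2
    omega

/-- Predecessors are unique, so the ancestors of `z` form a chain, along which the depth is strictly
monotone. -/
theorem Precedes.eq_of_depth_eq {x y z : I.Info} (hx : I.Precedes x z) (hy : I.Precedes y z)
    (hd : I.depth x = I.depth y) : x = y := by
  have hxs := Relation.reflTransGen_swap.2 hx
  have hys := Relation.reflTransGen_swap.2 hy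
  have huniq : Relator.RightUnique
      (Function.swap fun x x' : I.Info => ∃ a : I.Act x, I.parent x' = some ⟨x, a⟩) := by
    rintro a b c ⟨d, hd⟩ ⟨e, he⟩
    have := hd.symm.trans he
    simp only [Option.some.injEq, Sigma.mk.injEq] at this
    exact this.1
  rcases Relation.ReflTransGen.total_of_right_unique huniq hxs hys with h | h
  · exact (Precedes.eq_of_depth_le (Relation.reflTransGen_swap.1 h) (by simp [hd])).symm
  · exact Precedes.eq_of_depth_le (Relation.reflTransGen_swap.1 h) (by simp [hd])

-- Sub-trees with roots at a common depth are pairwise disjoint, so their sizes add up inside any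
-- set that contains them all.
open Classical in
theorem sum_subtreeActions_le (s : Finset I.Info) (h : Fin H) (hs : ∀ x ∈ s, I.depth x = h)
    (t : Finset I.Info) (ht : ∀ x ∈ s, ∀ z, I.Precedes x z → z ∈ t) :
    ∑ x ∈ s, I.subtreeActions x ≤ ∑ z ∈ t, Fintype.card (I.Act z) := by
  simp only [subtreeActions]
  rw [← Finset.sum_biUnion]
  · refine Finset.sum_le_sum_of_subset fun z hz => ?_
    simp only [Finset.mem_biUnion, Finset.mem_filter, Finset.mem_univ, true_and] at hz
    obtain ⟨x, hx, hz⟩ := hz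
    exact ht x hx z hz
  · intro x hx y hy hxy
    refine Finset.disjoint_left.2 fun z hz hz' => hxy ?_
    simp only [Finset.mem_filter, Finset.mem_univ, true_and] at hz hz'
    exact hz.eq_of_depth_eq hz' ((hs x hx).trans (hs y hy).symm)

theorem card_act_le_subtreeActions (x : I.Info) :
    Fintype.card (I.Act x) ≤ I.subtreeActions x := by
  classical
  rw [subtreeActions]
  exact Finset.single_le_sum (f := fun x' => Fintype.card (I.Act x')) (fun _ _ => Nat.zero_le _)
    (by simpa using Precedes.refl x)

theorem subtreeActions_pos (x : I.Info) : 0 < I.subtreeActions x :=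
  Fintype.card_pos.trans_le (card_act_le_subtreeActions x)

open Classical in
theorem sum_subtreeActions_roots_le :
    ∑ x : I.Info with I.parent x = none, I.subtreeActions x ≤ I.totalActions := by
  by_cases hne : ({x : I.Info | I.parent x = none} : Finset I.Info).Nonempty
  · obtain ⟨x₀, hx₀⟩ := hne
    refine sum_subtreeActions_le _ (I.depth x₀) (fun x hx => Fin.ext ?_) Finset.univ (by simp)
    simp only [Finset.mem_filter, Finset.mem_univ, true_and] at hx hx₀
    rw [(I.parent_eq_none_iff x).1 hx, (I.parent_eq_none_iff x₀).1 hx₀]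
  · rw [Finset.not_nonempty_iff_eq_empty.1 hne]
    simp

open Classical in
/-- Number of actions in the sub-trees that start right after the pair `q`. -/
noncomputable def childrenActions (q : I.Pair) : ℕ :=
  ∑ x' : I.Info with I.parent x' = some q, I.subtreeActions x'

-- The sub-tree at `x` contains the actions at `x` and, disjointly, the sub-trees of all children of
-- `x`. This is the inequality that telescopes in `IsFlow.sum_div_balanced_le`.
open Classical in
theorem card_act_add_sum_childrenActions_le (x : I.Info) :
    Fintype.card (I.Act x) + ∑ a, childrenActions (I := I) ⟨x, a⟩ ≤ I.subtreeActions x := by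
  have h1 : ∑ a, childrenActions (I := I) ⟨x, a⟩ =
      ∑ x' ∈ (Finset.univ : Finset (I.Act x)).biUnion
        (fun a => ({x' | I.parent x' = some ⟨x, a⟩} : Finset I.Info)), I.subtreeActions x' := by
    rw [Finset.sum_biUnion]
    · rfl
    · intro a _ b _ hab
      refine Finset.disjoint_left.2 fun z hz hz' => hab ?_
      simp only [Finset.mem_filter, Finset.mem_univ, true_and] at hz hz'
      have := hz.symm.trans hz'
      simpa using this
  have hdep : ∀ x' ∈ (Finset.univ : Finset (I.Act x)).biUnion
        (fun a => ({x' | I.parent x' = some ⟨x, a⟩} : Finset I.Info)),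
        (I.depth x' : ℕ) = I.depth x + 1 ∧ I.Precedes x x' := by
    intro x' hx'
    simp only [Finset.mem_biUnion, Finset.mem_filter, Finset.mem_univ, true_and] at hx'
    obtain ⟨a, ha⟩ := hx'
    exact ⟨I.depth_of_parent _ _ ha, Relation.ReflTransGen.single ⟨a, ha⟩⟩
  rw [h1, subtreeActions, ← Finset.add_sum_erase _ _
    (show x ∈ ({x' | I.Precedes x x'} : Finset I.Info) by
      simpa using Precedes.refl x)]
  refine Nat.add_le_add_left ?_ _
  set s := (Finset.univ : Finset (I.Act x)).biUnion
        (fun a => ({x' | I.parent x' = some ⟨x, a⟩} : Finset I.Info)) with hs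
  by_cases hne : s.Nonempty
  · obtain ⟨x₀, hx₀⟩ := hne
    refine sum_subtreeActions_le s (I.depth x₀)
      (fun y hy => Fin.ext ((hdep y hy).1.trans (hdep x₀ hx₀).1.symm)) _ fun y hy z hz => ?_
    simp only [Finset.mem_erase, Finset.mem_filter, Finset.mem_univ, true_and]
    refine ⟨?_, (hdep y hy).2.trans hz⟩
    rintro rfl
    have := hz.depth_le
    have := (hdep y hy).1
    omega
  · rw [Finset.not_nonempty_iff_eq_empty.1 hne]
    simp

theorem totalActions_pos (x : I.Info) : 0 < I.totalActions :=
  Fintype.card_pos.trans_le (Finset.single_le_sum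
    (f := fun x : I.Info => Fintype.card (I.Act x)) (fun _ _ => Nat.zero_le _) (Finset.mem_univ x))

theorem childrenActions_pos {x : I.Info} {q : I.Pair} (h : I.parent x = some q) :
    0 < childrenActions q := by
  classical
  rw [childrenActions]
  exact (subtreeActions_pos x).trans_le (Finset.single_le_sum (fun _ _ => Nat.zero_le _)
    (by simpa using h))

theorem balancedStep_of_none {x : I.Info} (h : I.parent x = none) :
    I.balancedStep x = I.subtreeActions x / I.totalActions := by
  rw [balancedStep]
  split <;> simp_all

theorem balancedStep_of_some {x : I.Info} {q : I.Pair} (h : I.parent x = some q) :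
    I.balancedStep x = I.subtreeActions x / childrenActions q := by
  rw [balancedStep]
  split <;> rename_i h'
  · simp_all
  · obtain rfl := Option.some.inj (h'.symm.trans h)
    simp [childrenActions]

theorem balanced_of_none {x : I.Info} (h : I.parent x = none) :
    I.balanced x = I.subtreeActions x / I.totalActions := by
  simp [balanced_eq x, h, balancedStep_of_none h]

theorem balanced_of_some {x : I.Info} {q : I.Pair} (h : I.parent x = some q) :
    I.balanced x = I.balanced q.1 * (I.subtreeActions x / childrenActions q) := by
  simp [balanced_eq x, h, balancedStep_of_some h]

theorem balanced_pos (x : I.Info) : 0 < I.balanced x := by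
  induction x using info_induction with
  | h x ih =>
    have hs : (0 : ℝ) < I.subtreeActions x := by exact_mod_cast subtreeActions_pos x
    cases hp : I.parent x with
    | none =>
      rw [balanced_of_none hp]
      exact div_pos hs (by exact_mod_cast totalActions_pos x)
    | some q =>
      rw [balanced_of_some hp]
      exact mul_pos (ih q hp) (div_pos hs (by exact_mod_cast childrenActions_pos hp))

-- Every information set is either a root or the child of exactly one pair; this regrouping drives
-- both recursions over depth.
open Classical in
theorem sum_info_eq (f : I.Info → ℝ) :
    ∑ x, f x = ∑ x with I.parent x = none, f x +
      ∑ q : I.Pair, ∑ x with I.parent x = some q, f x := by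
  rw [← Finset.sum_fiberwise Finset.univ I.parent f, Fintype.sum_option]

open Classical in
/-- At each depth, the balanced transitions and a realization plan form a sub-probability. -/
theorem sum_balanced_mul_plan_le (μ : I.Policy) (h : Fin H) :
    ∑ q : I.Pair with I.depth q.1 = h, I.balanced q.1 * μ.plan q ≤ 1 := by
  obtain ⟨n, hn⟩ := h
  induction n with
  | zero =>
    calc ∑ q : I.Pair with I.depth q.1 = ⟨0, hn⟩, I.balanced q.1 * μ.plan q
        = ∑ x : I.Info with I.parent x = none, I.balanced x := by
          rw [Finset.sum_filter, Fintype.sum_sigma, Finset.sum_filter]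
          refine Finset.sum_congr rfl fun x _ => ?_
          by_cases hx : I.parent x = none
          · have : I.depth x = ⟨0, hn⟩ := Fin.ext ((I.parent_eq_none_iff x).1 hx)
            simp [this, hx, ← Finset.mul_sum, μ.sum_plan, μ.reach_of_none hx]
          · have : I.depth x ≠ ⟨0, hn⟩ := fun h =>
              hx ((I.parent_eq_none_iff x).2 (by rw [h]))
            simp [this, hx]
      _ = ((∑ x : I.Info with I.parent x = none, I.subtreeActions x : ℕ) : ℝ) /
            I.totalActions := by
          push_cast
          rw [Finset.sum_div]
          refine Finset.sum_congr rfl fun x hx => balanced_of_none ?_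
          simpa using hx
      _ ≤ 1 := div_le_one_of_le₀ (by exact_mod_cast sum_subtreeActions_roots_le) (by positivity)
  | succ n ih =>
    refine le_trans ?_ (ih (by omega))
    calc ∑ q : I.Pair with I.depth q.1 = ⟨n + 1, hn⟩, I.balanced q.1 * μ.plan q
        = ∑ x : I.Info, if I.depth x = ⟨n + 1, hn⟩ then I.balanced x * μ.reach x else 0 := by
          rw [Finset.sum_filter, Fintype.sum_sigma]
          refine Finset.sum_congr rfl fun x _ => ?_
          by_cases hx : I.depth x = ⟨n + 1, hn⟩
          · simp [hx, ← Finset.mul_sum, μ.sum_plan]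
          · simp [hx]
      _ = ∑ q : I.Pair, ∑ x with I.parent x = some q,
            if I.depth x = ⟨n + 1, hn⟩ then I.balanced x * μ.reach x else 0 := by
          rw [sum_info_eq, add_eq_right]
          refine Finset.sum_eq_zero fun x hx => if_neg fun h => ?_
          simp only [Finset.mem_filter, Finset.mem_univ, true_and] at hx
          have := (I.parent_eq_none_iff x).1 hx
          rw [h] at this
          simp at this
      _ ≤ _ := by
          rw [Finset.sum_filter]
          refine Finset.sum_le_sum fun q _ => ?_
          have key : ∀ x ∈ ({x | I.parent x = some q} : Finset I.Info),
              (if I.depth x = ⟨n + 1, hn⟩ then I.balanced x * μ.reach x else 0) =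
              if I.depth q.1 = ⟨n, by omega⟩ then
                I.balanced q.1 * μ.plan q * ((I.subtreeActions x : ℝ) / childrenActions q)
              else 0 := by
            intro x hx
            simp only [Finset.mem_filter, Finset.mem_univ, true_and] at hx
            have h1 := I.depth_of_parent x q hx
            have h2 : I.depth x = ⟨n + 1, hn⟩ ↔ I.depth q.1 = ⟨n, by omega⟩ := by
              simp only [Fin.ext_iff]
              omega
            simp only [h2, balanced_of_some hx, μ.reach_of_some hx]
            split_ifs
            · ring
            · rfl
          rw [Finset.sum_congr rfl key]
          split_ifs
          · rw [← Finset.mul_sum, ← Finset.sum_div]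
            refine mul_le_of_le_one_right
              (mul_nonneg (balanced_pos _).le (μ.plan_nonneg _)) ?_
            rw [childrenActions]
            push_cast
            -- The transitions out of `q` sum to `1`, or to `0 / 0 = 0` if nothing follows `q`; the
            -- inequality covers both.
            exact div_self_le_one _
          · simp

theorem balanced_mul_plan_le_one (μ : I.Policy) (q : I.Pair) :
    I.balanced q.1 * μ.plan q ≤ 1 := by
  classical
  refine le_trans ?_ (sum_balanced_mul_plan_le μ (I.depth q.1))
  exact Finset.single_le_sum (f := fun q : I.Pair => I.balanced q.1 * μ.plan q)
    (fun q _ => mul_nonneg (balanced_pos _).le (μ.plan_nonneg _)) (by simp)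

theorem sum_pair_eq_sum_depth (f : I.Pair → ℝ) [∀ h, DecidablePred fun q : I.Pair => I.depth q.1 = h] :
    ∑ q, f q = ∑ h, ∑ q : I.Pair with I.depth q.1 = h, f q := by
  rw [← Finset.sum_fiberwise Finset.univ (fun q : I.Pair => I.depth q.1) f]
  refine Finset.sum_congr rfl fun h _ => Finset.sum_congr ?_ fun _ _ => rfl
  ext q
  simp

theorem sum_balanced_mul_plan_le_length (μ : I.Policy) :
    ∑ q : I.Pair, I.balanced q.1 * μ.plan q ≤ H := by
  classical
  rw [sum_pair_eq_sum_depth]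
  refine (Finset.sum_le_sum fun h _ => ?_).trans (b := ∑ _h : Fin H, (1 : ℝ)) (by simp)
  convert sum_balanced_mul_plan_le μ h

open Classical in
/-- A sub-probability flow through the tree, such as the transitions that a fixed opponent
induces. -/
structure IsFlow (f : I.Info → ℝ) : Prop where
  nonneg : ∀ x, 0 ≤ f x
  sum_root_le : ∑ x with I.parent x = none, f x ≤ 1
  sum_child_le : ∀ q : I.Pair, ∑ x with I.parent x = some q, f x ≤ f q.1

/-- The defining property of the balanced transitions. -/
theorem IsFlow.sum_div_balanced_le {f : I.Info → ℝ} (hf : IsFlow f) :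
    ∑ q : I.Pair, f q.1 / I.balanced q.1 ≤ I.totalActions := by
  classical
  -- `D` is the telescoping potential. Multiplying by the sub-tree size cancels the numerator of the
  -- balanced step, so summing `D` over siblings only sees the flow into them.
  set D : I.Info → ℝ := fun x => f x / I.balanced x * I.subtreeActions x with hD
  have hroot : ∑ x with I.parent x = none, D x ≤ I.totalActions := by
    calc ∑ x with I.parent x = none, D x
        = ∑ x with I.parent x = none, f x * I.totalActions := by
          refine Finset.sum_congr rfl fun x hx => ?_
          simp only [Finset.mem_filter, Finset.mem_univ, true_and] at hx
          have h1 : (I.subtreeActions x : ℝ) ≠ 0 := by exact_mod_cast (subtreeActions_pos x).ne'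
          have h2 : (I.totalActions : ℝ) ≠ 0 := by exact_mod_cast (totalActions_pos x).ne'
          simp only [hD, balanced_of_none hx]
          field_simp
      _ ≤ _ := by
          rw [← Finset.sum_mul]
          exact mul_le_of_le_one_left (by positivity) hf.sum_root_le
  have hchild : ∀ q : I.Pair, ∑ x with I.parent x = some q, D x ≤
      f q.1 / I.balanced q.1 * childrenActions q := by
    intro q
    calc ∑ x with I.parent x = some q, D x
        = ∑ x with I.parent x = some q, f x * (childrenActions q / I.balanced q.1) := by
          refine Finset.sum_congr rfl fun x hx => ?_
          simp only [Finset.mem_filter, Finset.mem_univ, true_and] at hx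
          have h1 : (I.subtreeActions x : ℝ) ≠ 0 := by exact_mod_cast (subtreeActions_pos x).ne'
          have h2 : (childrenActions q : ℝ) ≠ 0 := by exact_mod_cast (childrenActions_pos hx).ne'
          have h3 := (balanced_pos q.1).ne'
          simp only [hD, balanced_of_some hx]
          field_simp
      _ ≤ _ := by
          rw [← Finset.sum_mul, div_mul_eq_mul_div, mul_div_assoc]
          exact mul_le_mul_of_nonneg_right (hf.sum_child_le q)
            (div_nonneg (by positivity) (balanced_pos _).le)
  have hsub : ∑ q : I.Pair, f q.1 / I.balanced q.1 * childrenActions q +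
      ∑ q : I.Pair, f q.1 / I.balanced q.1 ≤ ∑ x, D x := by
    rw [← Finset.sum_add_distrib, Fintype.sum_sigma]
    refine Finset.sum_le_sum fun x _ => ?_
    have h1 : ((Fintype.card (I.Act x) + ∑ a, childrenActions (I := I) ⟨x, a⟩ : ℕ) : ℝ) ≤
        I.subtreeActions x := by exact_mod_cast card_act_add_sum_childrenActions_le x
    have h2 := mul_le_mul_of_nonneg_left h1 (div_nonneg (hf.nonneg x) (balanced_pos x).le)
    refine le_trans (le_of_eq ?_) h2
    rw [Finset.sum_add_distrib]
    push_cast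
    rw [mul_add, Finset.mul_sum, Finset.sum_const, Finset.card_univ, nsmul_eq_mul]
    ring
  -- Split into roots and children, `∑ D` exceeds the wanted sum plus the terms that `hchild` allots
  -- to the children. Those terms cancel and only the roots remain.
  rw [sum_info_eq D] at hsub
  have := Finset.sum_le_sum fun q (_ : q ∈ Finset.univ) => hchild q
  linarith

end InfoTree

/-! ### One-dimensional estimates for the two regularizers -/

namespace Entropy

/-- The derivative of `Entropy.term`. -/
noncomputable def slope : Entropy → ℝ → ℝ
  | shannon, w => Real.log w + 1
  | tsallis q, w => -((q : ℝ) * w ^ ((q : ℝ) - 1))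

/-- The local norm of the regularizer at `w` is `1 / (weight w * w)`, up to a constant. -/
noncomputable def weight : Entropy → ℝ → ℝ
  | shannon, _ => 1
  | tsallis q, w => w ^ (1 - (q : ℝ))

/-- The constant in the stability estimate of the regularizer. -/
noncomputable def curv : Entropy → ℝ
  | shannon => 1
  | tsallis q => 1 / ((q : ℝ) * (1 - q))

theorem curv_pos (R : Entropy) : 0 < R.curv := by
  cases R with
  | shannon => exact one_pos
  | tsallis q => exact one_div_pos.2 (mul_pos q.2.1 (sub_pos.2 q.2.2))

theorem weight_nonneg (R : Entropy) {w : ℝ} (hw : 0 ≤ w) : 0 ≤ R.weight w := by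
  cases R with
  | shannon => exact zero_le_one
  | tsallis q => exact Real.rpow_nonneg hw _

theorem weight_le_one (R : Entropy) {w : ℝ} (hw : 0 ≤ w) (hw1 : w ≤ 1) : R.weight w ≤ 1 := by
  cases R with
  | shannon => exact le_rfl
  | tsallis q => exact Real.rpow_le_one hw hw1 (sub_pos.2 q.2.2).le

theorem term_zero (R : Entropy) : R.term 0 = 0 := by
  cases R with
  | shannon => simp [term]
  | tsallis q => simp [term, Real.zero_rpow q.2.1.ne']

theorem hasDerivAt_term (R : Entropy) {w : ℝ} (hw : 0 < w) :
    HasDerivAt R.term (R.slope w) w := by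
  cases R with
  | shannon => exact Real.hasDerivAt_mul_log hw.ne'
  | tsallis q =>
    have := (Real.hasDerivAt_rpow_const (x := w) (p := (q : ℝ)) (Or.inl hw.ne')).neg
    exact this

theorem convexOn_term (R : Entropy) : ConvexOn ℝ (Set.Ici 0) R.term := by
  cases R with
  | shannon => exact Real.convexOn_mul_log
  | tsallis q => exact (Real.concaveOn_rpow q.2.1.le q.2.2.le).neg

/-- The regularizer is infinitely steep at `0`. -/
theorem exists_term_mul_le (R : Entropy) {v : ℝ} (hv : 0 < v) (M : ℝ) :
    ∃ s, 0 < s ∧ s ≤ 1 ∧ R.term (s * v) ≤ s * M := by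
  cases R with
  | shannon =>
    -- The second entry of the minimum is the value of `s` at which `log (s v) = M / v`.
    refine ⟨min 1 (Real.exp (M / v) / v), lt_min one_pos (div_pos (Real.exp_pos _) hv),
      min_le_left _ _, ?_⟩
    set s := min 1 (Real.exp (M / v) / v) with hs
    have hs0 : 0 < s := lt_min one_pos (div_pos (Real.exp_pos _) hv)
    have h1 : s * v ≤ Real.exp (M / v) := (le_div_iff₀ hv).1 (min_le_right _ _)
    have h2 : Real.log (s * v) ≤ M / v := (Real.log_le_iff_le_exp (mul_pos hs0 hv)).2 h1
    calc s * v * Real.log (s * v) ≤ s * v * (M / v) :=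
          mul_le_mul_of_nonneg_left h2 (mul_pos hs0 hv).le
      _ = s * M := by field_simp
  | tsallis q =>
    have hq1 : (0 : ℝ) < 1 - q := sub_pos.2 q.2.2
    -- Chosen so that `s ^ (1 - q) * (|M| + 1) ≤ v ^ q`; multiplied by `s ^ q` this gives `s * (|M|
    -- + 1) ≤ (s v) ^ q`.
    set d := v ^ (q : ℝ) / (|M| + 1) with hd
    have hM : 0 < |M| + 1 := by positivity
    have hd0 : 0 < d := div_pos (Real.rpow_pos_of_pos hv _) hM
    set s := min 1 (d ^ (1 / (1 - (q : ℝ)))) with hs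
    have hs0 : 0 < s := lt_min one_pos (Real.rpow_pos_of_pos hd0 _)
    refine ⟨s, hs0, min_le_left _ _, ?_⟩
    have h1 : s ^ (1 - (q : ℝ)) ≤ d := by
      calc s ^ (1 - (q : ℝ)) ≤ (d ^ (1 / (1 - (q : ℝ)))) ^ (1 - (q : ℝ)) :=
            Real.rpow_le_rpow hs0.le (min_le_right _ _) hq1.le
        _ = d := by rw [← Real.rpow_mul hd0.le, one_div_mul_cancel hq1.ne', Real.rpow_one]
    have h2 : s ^ (q : ℝ) * s ^ (1 - (q : ℝ)) = s := by
      rw [← Real.rpow_add hs0]; simp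
    have h3 : s ^ (1 - (q : ℝ)) * (|M| + 1) ≤ v ^ (q : ℝ) := (le_div_iff₀ hM).1 h1
    simp only [term]
    rw [Real.mul_rpow hs0.le hv.le]
    have h4 := mul_le_mul_of_nonneg_left h3 (Real.rpow_nonneg hs0.le (q : ℝ))
    rw [← mul_assoc, h2] at h4
    nlinarith [neg_abs_le M]

/-- A quadratic lower bound for the Bregman divergence of `-x ^ q` at `1`. With `x = y ^ 2`,
Bernoulli's inequality for the exponent `2q` (if `q ≤ 1/2`) or `2q - 1` (otherwise) leaves exactly
`q (1 - y)^2` or `(1 - q) (1 - y)^2`. Both dominate `q (1 - q) (1 - y)^2`, and `(1 - x)^2 ≤ 4 (1 -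
y)^2`. -/
theorem one_sub_rpow_ge {q x : ℝ} (hq0 : 0 < q) (hq1 : q < 1) (hx : 0 ≤ x) (hx1 : x ≤ 1) :
    q * (1 - q) / 4 * (1 - x) ^ 2 ≤ 1 - x ^ q + q * (x - 1) := by
  set y := √x with hy
  have hy0 : 0 ≤ y := Real.sqrt_nonneg x
  have hyy : x = y ^ 2 := (Real.sq_sqrt hx).symm
  have hy1 : y ≤ 1 := Real.sqrt_le_one.2 hx1
  have h1 : (1 - x) ^ 2 ≤ 4 * (1 - y) ^ 2 := by
    have : (1 - x) ^ 2 = (1 - y) ^ 2 * (1 + y) ^ 2 := by rw [hyy]; ring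
    rw [this]
    nlinarith [sq_nonneg (1 - y), mul_nonneg (sq_nonneg (1 - y)) hy0,
      mul_nonneg (sq_nonneg (1 - y)) (sub_nonneg.2 hy1)]
  have hyq : x ^ q = y ^ (2 * q) := by
    rw [hyy, ← Real.rpow_natCast, ← Real.rpow_mul hy0]; norm_num
  suffices h : q * (1 - q) * (1 - y) ^ 2 ≤ 1 - x ^ q + q * (x - 1) by
    nlinarith [mul_pos hq0 (sub_pos.2 hq1)]
  rcases le_total q (1 / 2) with h | h
  · have h2 := rpow_one_add_le_one_add_mul_self (s := y - 1) (by linarith)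
      (p := 2 * q) (by linarith) (by linarith)
    rw [add_sub_cancel] at h2
    rw [hyq]
    nlinarith [mul_nonneg (mul_pos hq0 hq0).le (sq_nonneg (1 - y))]
  · have h2 := rpow_one_add_le_one_add_mul_self (s := y - 1) (by linarith)
      (p := 2 * q - 1) (by linarith) (by linarith)
    rw [add_sub_cancel] at h2
    have h3 : x ^ q = y * y ^ (2 * q - 1) := by
      rcases hy0.eq_or_lt with h0 | h0
      · rw [hyq, ← h0, Real.zero_rpow (by linarith), zero_mul]
      · rw [hyq, ← Real.rpow_one_add' h0.le (by linarith)]; ring_nf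
    rw [h3]
    have h4 := mul_le_mul_of_nonneg_left h2 hy0
    nlinarith [mul_nonneg (mul_pos (sub_pos.2 hq1) (sub_pos.2 hq1)).le (sq_nonneg (1 - y))]

/-- Follows from `exp g ≥ 1 + g` and `(1 + g)(1 - g + g ^ 2) = 1 + g ^ 3 ≥ 1`. -/
theorem exp_neg_le {g : ℝ} (hg : 0 ≤ g) : Real.exp (-g) ≤ 1 - g + g ^ 2 := by
  have h1 := Real.add_one_le_exp g
  rw [Real.exp_neg]
  calc (Real.exp g)⁻¹ ≤ (g + 1)⁻¹ := inv_anti₀ (by linarith) h1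
    _ ≤ 1 - g + g ^ 2 := by
      rw [inv_le_iff_one_le_mul₀ (by linarith)]
      nlinarith [pow_nonneg hg 3]

/-- One coordinate of the stability estimate of follow-the-regularized-leader. -/
theorem stability (R : Entropy) {u v g : ℝ} (hu : 0 < u) (hv : 0 ≤ v) (hg : 0 ≤ g) :
    -(R.curv * R.weight u * u * g ^ 2) ≤
      R.term v - R.term u - R.slope u * (v - u) + g * (v - u) := by
  cases R with
  | shannon =>
    simp only [curv, weight, term, slope, one_mul]
    have hexp := exp_neg_le hg
    rcases hv.eq_or_lt with rfl | hv
    · have : Real.exp (-g) ≥ 0 := (Real.exp_pos _).le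
      nlinarith
    · have h1 := Real.add_one_le_exp (Real.log u - g - Real.log v)
      rw [Real.exp_sub, Real.exp_log hv, sub_eq_add_neg (Real.log u), Real.exp_add,
        Real.exp_log hu, le_div_iff₀ hv] at h1
      nlinarith [mul_le_mul_of_nonneg_left hexp hu.le]
  | tsallis q =>
    obtain ⟨q, hq0, hq1⟩ := q
    simp only [curv, weight, term, slope]
    have hK : 0 < q * (1 - q) := mul_pos hq0 (sub_pos.2 hq1)
    have hx0 : 0 ≤ v / u := div_nonneg hv hu.le
    have huq : 0 < u ^ q := Real.rpow_pos_of_pos hu q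
    have hu1 : u ^ q * u ^ (1 - q) = u := by rw [← Real.rpow_add hu]; simp
    have hu2 : u ^ (q - 1) * u = u ^ q := by rw [Real.rpow_sub_one hu.ne']; field_simp
    have hvq : v ^ q = u ^ q * (v / u) ^ q := by
      rw [← Real.mul_rpow hu.le hx0, mul_div_cancel₀ _ hu.ne']
    -- By homogeneity, `x = v / u` and this rescaled slope reduce the claim to the case `u = 1`,
    -- which is `key`.
    set G := g * u ^ (1 - q) with hG
    have hG0 : 0 ≤ G := mul_nonneg hg (Real.rpow_nonneg hu.le _)
    have hvx : v = u * (v / u) := (mul_div_cancel₀ _ hu.ne').symm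
    set x := v / u with hx
    have key : -(1 / (q * (1 - q)) * G ^ 2) ≤ 1 - x ^ q + q * (x - 1) + G * (x - 1) := by
      -- Below `1`, complete the square with the quadratic bound. Above `1`, the linear term has the
      -- favourable sign and convexity suffices.
      rcases le_total x 1 with h | h
      · have h1 := one_sub_rpow_ge hq0 hq1 hx0 h
        have h2 : 0 ≤ (q * (1 - q) / 2 * (1 - x) - G) ^ 2 / (q * (1 - q)) := by positivity
        have h3 : (q * (1 - q) / 2 * (1 - x) - G) ^ 2 / (q * (1 - q)) =
            q * (1 - q) / 4 * (1 - x) ^ 2 + G * (x - 1) + 1 / (q * (1 - q)) * G ^ 2 := by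
          field_simp
          ring
        linarith
      · have h1 := rpow_one_add_le_one_add_mul_self (s := x - 1) (by linarith)
          (p := q) hq0.le hq1.le
        rw [add_sub_cancel] at h1
        have h2 : 0 ≤ G * (x - 1) := mul_nonneg hG0 (sub_nonneg.2 h)
        have h3 : 0 ≤ 1 / (q * (1 - q)) * G ^ 2 := by positivity
        linarith
    have e1 : 1 / (q * (1 - q)) * u ^ (1 - q) * u * g ^ 2 =
        u ^ q * (1 / (q * (1 - q)) * G ^ 2) := by
      rw [hG]
      calc _ = 1 / (q * (1 - q)) * u ^ (1 - q) * (u ^ q * u ^ (1 - q)) * g ^ 2 := by rw [hu1]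
        _ = _ := by ring
    have e2 : -v ^ q - -u ^ q - -(q * u ^ (q - 1)) * (v - u) + g * (v - u) =
        u ^ q * (1 - x ^ q + q * (x - 1) + G * (x - 1)) := by
      have e3 : q * u ^ (q - 1) * (v - u) = u ^ q * (q * (x - 1)) := by
        rw [← hu2]
        nth_rewrite 1 [hvx]
        ring
      have e4 : g * (v - u) = u ^ q * (G * (x - 1)) := by
        rw [hG]
        calc g * (v - u) = g * (x - 1) * (u ^ q * u ^ (1 - q)) := by
              rw [hu1]
              nth_rewrite 1 [hvx]
              ring
          _ = _ := by ring
      rw [hvq]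
      linarith
    rw [e1, e2, ← mul_neg]
    exact mul_le_mul_of_nonneg_left key huq.le

/-- The range of the regularizer, for weights that sum to at most `H`. -/
noncomputable def range : Entropy → ℕ → ℕ → ℝ
  | shannon, A, H => H * Real.log A + 1
  | tsallis q, A, H => A * ((H : ℝ) / A) ^ (q : ℝ)

/-- A bound on the average of `weight`. -/
noncomputable def meanWeight : Entropy → ℕ → ℕ → ℝ
  | shannon, _, _ => 1
  | tsallis q, A, H => ((H : ℝ) / A) ^ (1 - (q : ℝ))

/-- The concave function `x ^ p` lies below its tangent at `m`. Taken at the mean `m = H / A` and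
summed, it replaces Jensen's inequality. -/
theorem rpow_le_tangent {m x p : ℝ} (hm : 0 < m) (hx : 0 ≤ x) (hp0 : 0 ≤ p) (hp1 : p ≤ 1) :
    x ^ p ≤ m ^ p * (1 - p + p * (x / m)) := by
  have h1 := rpow_one_add_le_one_add_mul_self (s := x / m - 1)
    (by linarith [div_nonneg hx hm.le]) hp0 hp1
  rw [add_sub_cancel, Real.div_rpow hx hm.le, div_le_iff₀ (Real.rpow_pos_of_pos hm _)] at h1
  linarith

/-- The competitor contributes at most `0`, as its coordinates lie in `[0, 1]`. For `u`, Shannon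
entropy is compared with the constant vector `1 / A`, which costs the additive `1`; for Tsallis,
concavity makes the constant vector `H / A` the worst case. -/
theorem sum_term_sub_le (R : Entropy) {ι : Type*} [Fintype ι] {A H : ℕ} (hA : 0 < A) (hH : 0 < H)
    (hcard : Fintype.card ι = A) {u v : ι → ℝ} (hu : ∀ i, 0 ≤ u i) (hv : ∀ i, 0 ≤ v i)
    (hv1 : ∀ i, v i ≤ 1) (hsum : ∑ i, u i ≤ H) :
    ∑ i, R.term (v i) - ∑ i, R.term (u i) ≤ R.range A H := by
  have hA' : (0 : ℝ) < A := by exact_mod_cast hA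
  have hH' : (0 : ℝ) < H := by exact_mod_cast hH
  cases R with
  | shannon =>
    simp only [term, range]
    have h1 : ∑ i, v i * Real.log (v i) ≤ 0 :=
      Finset.sum_nonpos fun i _ => Real.mul_log_nonpos (hv i) (hv1 i)
    have h2 : ∀ i, -(u i * Real.log (u i)) ≤ u i * Real.log A + 1 / A := by
      intro i
      rcases (hu i).eq_or_lt with h0 | h0
      · rw [← h0]; simp
      · have h3 := Real.one_sub_inv_le_log_of_pos (mul_pos hA' h0)
        rw [Real.log_mul hA'.ne' h0.ne'] at h3
        have h4 := mul_le_mul_of_nonneg_left h3 h0.le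
        have h5 : u i * (1 - (A * u i)⁻¹) = u i - 1 / A := by field_simp
        linarith
    have h3 := Finset.sum_le_sum fun i (_ : i ∈ Finset.univ) => h2 i
    rw [Finset.sum_neg_distrib, Finset.sum_add_distrib, ← Finset.sum_mul, Finset.sum_const,
      Finset.card_univ, hcard, nsmul_eq_mul, mul_one_div_cancel hA'.ne'] at h3
    have h4 := mul_le_mul_of_nonneg_right hsum (Real.log_natCast_nonneg A)
    linarith
  | tsallis q =>
    simp only [term, range, Finset.sum_neg_distrib]
    have h1 : 0 ≤ ∑ i, v i ^ (q : ℝ) := Finset.sum_nonneg fun i _ => Real.rpow_nonneg (hv i) _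
    have hm : (0 : ℝ) < H / A := div_pos hH' hA'
    have h2 := Finset.sum_le_sum fun i (_ : i ∈ Finset.univ) =>
      rpow_le_tangent hm (hu i) q.2.1.le q.2.2.le
    rw [← Finset.mul_sum, Finset.sum_add_distrib, Finset.sum_const, ← Finset.mul_sum,
      ← Finset.sum_div, Finset.card_univ, hcard, nsmul_eq_mul] at h2
    have h3 : (∑ i, u i) / (H / A : ℝ) ≤ A := by
      rw [div_le_iff₀ hm, mul_div_cancel₀ _ hA'.ne']
      exact hsum
    have h4 : (A : ℝ) * (1 - q) + q * ((∑ i, u i) / (H / A : ℝ)) ≤ A := by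
      nlinarith [q.2.1]
    have h5 := mul_le_mul_of_nonneg_left h4 (Real.rpow_nonneg hm.le (q : ℝ))
    linarith

/-- Weighted Jensen: the tangent at `H / A` is affine in `u`, so only the two budgets `∑ w ≤ A` and
`∑ w u ≤ H` enter. -/
theorem sum_mul_weight_le (R : Entropy) {ι : Type*} [Fintype ι] {A H : ℕ} (hA : 0 < A)
    (hH : 0 < H) {w u : ι → ℝ} (hw : ∀ i, 0 ≤ w i) (hu : ∀ i, 0 ≤ u i)
    (hsum : ∑ i, w i ≤ A) (hsum' : ∑ i, w i * u i ≤ H) :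
    ∑ i, R.weight (u i) * w i ≤ A * R.meanWeight A H := by
  have hA' : (0 : ℝ) < A := by exact_mod_cast hA
  have hH' : (0 : ℝ) < H := by exact_mod_cast hH
  cases R with
  | shannon => simpa [weight, meanWeight] using hsum
  | tsallis q =>
    simp only [weight, meanWeight]
    have hq := q.2.1
    have hq1 := q.2.2
    have hm : (0 : ℝ) < H / A := div_pos hH' hA'
    have h2 := Finset.sum_le_sum fun i (_ : i ∈ Finset.univ) => mul_le_mul_of_nonneg_right
      (rpow_le_tangent hm (hu i) (p := 1 - (q : ℝ)) (by linarith) (by linarith)) (hw i)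
    refine h2.trans ?_
    have h3 : ∑ i, ((H : ℝ) / A) ^ (1 - (q : ℝ)) *
          (1 - (1 - (q : ℝ)) + (1 - q) * (u i / (H / A : ℝ))) * w i =
        ((H : ℝ) / A) ^ (1 - (q : ℝ)) *
          (q * ∑ i, w i + (1 - q) * ((∑ i, w i * u i) / (H / A : ℝ))) := by
      rw [Finset.sum_div, Finset.mul_sum, Finset.mul_sum, ← Finset.sum_add_distrib,
        Finset.mul_sum]
      refine Finset.sum_congr rfl fun i _ => ?_
      ring
    have h4 : (∑ i, w i * u i) / (H / A : ℝ) ≤ A := by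
      rw [div_le_iff₀ hm, mul_div_cancel₀ _ hA'.ne']
      exact hsum'
    rw [h3, mul_comm (A : ℝ)]
    refine mul_le_mul_of_nonneg_left ?_ (Real.rpow_nonneg hm.le _)
    nlinarith

end Entropy

/-! ### Follow-the-regularized-leader on the tree -/

namespace InfoTree

variable {H : ℕ} {I : InfoTree.{u} H}

theorem objective_eq (R : Entropy) (η : ℝ) (L : I.Pair → ℝ) (μ : I.Policy) :
    objective R (fun _ => η) L μ =
      ∑ q, (μ.plan q * L q + R.term (I.balanced q.1 * μ.plan q) / η) := by
  classical
  rw [objective, Finset.sum_add_distrib, ← Finset.sum_div, ← Finset.sum_div,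
    sum_pair_eq_sum_depth (fun q => R.term (I.balanced q.1 * μ.plan q))]
  congr 2

/-- Replacing a fraction `s` of the plan of a minimizer does not decrease the objective. -/
theorem objective_min_le_mix {R : Entropy} {η : ℝ} {L : I.Pair → ℝ} {μ : I.Policy}
    (hmin : ∀ μ', objective R (fun _ => η) L μ ≤ objective R (fun _ => η) L μ')
    (μ' : I.Policy) {s : ℝ} (hs0 : 0 ≤ s) (hs1 : s ≤ 1) :
    ∑ q, (μ.plan q * L q + R.term (I.balanced q.1 * μ.plan q) / η) ≤
      ∑ q, ((μ.plan q + s * (μ'.plan q - μ.plan q)) * L q +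
        R.term (I.balanced q.1 * (μ.plan q + s * (μ'.plan q - μ.plan q))) / η) := by
  obtain ⟨ν, hν⟩ := exists_policy_plan_eq_sum (fun b : Bool => if b then s else 1 - s)
    (fun b => by cases b <;> simp [hs0, hs1]) (by simp) (fun b : Bool => if b then μ' else μ)
  have hν' : ∀ q, ν.plan q = μ.plan q + s * (μ'.plan q - μ.plan q) := by
    intro q
    rw [hν]
    simp
    ring
  have h := hmin ν
  rw [objective_eq, objective_eq] at h
  simpa only [hν'] using h

/-- If a coordinate of the minimizer vanished, mixing in a fraction `s` of the uniform policy would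
cost at most `s * B` elsewhere by convexity, while the infinite slope of the regularizer at `0`
gains more. Positivity makes the regularizer differentiable at the minimizer. -/
theorem plan_pos_of_objective_min {R : Entropy} {η : ℝ} (hη : 0 < η) {L : I.Pair → ℝ}
    {μ : I.Policy}
    (hmin : ∀ μ', objective R (fun _ => η) L μ ≤ objective R (fun _ => η) L μ')
    (q : I.Pair) : 0 < μ.plan q := by
  classical
  refine (μ.plan_nonneg q).lt_of_ne' fun h0 => ?_
  set μ' := I.uniformPolicy
  have hb := fun x : I.Info => balanced_pos x
  have hv : 0 < I.balanced q.1 * μ'.plan q := mul_pos (hb _) (uniformPolicy_plan_pos q)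
  set B := ∑ q', (μ'.plan q' - μ.plan q') * L q' +
    ∑ q' ∈ Finset.univ.erase q, (R.term (I.balanced q'.1 * μ'.plan q') -
      R.term (I.balanced q'.1 * μ.plan q')) / η with hB
  -- With this `M` the coordinate `q` contributes at most `-s * (B + 1)`, so the objective would
  -- drop by at least `s`.
  obtain ⟨s, hs0, hs1, hs⟩ := R.exists_term_mul_le hv (-(η * (B + 1)))
  have h := objective_min_le_mix hmin μ' hs0.le hs1
  have hconv : ∀ q' : I.Pair,
      R.term (I.balanced q'.1 * (μ.plan q' + s * (μ'.plan q' - μ.plan q'))) / η ≤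
        R.term (I.balanced q'.1 * μ.plan q') / η +
          s * ((R.term (I.balanced q'.1 * μ'.plan q') -
            R.term (I.balanced q'.1 * μ.plan q')) / η) := by
    intro q'
    have := R.convexOn_term.2 (x := I.balanced q'.1 * μ.plan q')
      (y := I.balanced q'.1 * μ'.plan q') (mul_nonneg (hb _).le (μ.plan_nonneg _))
      (mul_nonneg (hb _).le (μ'.plan_nonneg _)) (sub_nonneg.2 hs1) hs0.le (by ring)
    simp only [smul_eq_mul] at this
    rw [show I.balanced q'.1 * (μ.plan q' + s * (μ'.plan q' - μ.plan q')) =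
      (1 - s) * (I.balanced q'.1 * μ.plan q') + s * (I.balanced q'.1 * μ'.plan q') by ring]
    rw [← mul_div_assoc, ← add_div]
    exact div_le_div_of_nonneg_right (by linarith) hη.le
  have hq : R.term (I.balanced q.1 * (μ.plan q + s * (μ'.plan q - μ.plan q))) / η ≤
      -(s * (B + 1)) := by
    rw [h0, zero_add, sub_zero, div_le_iff₀ hη]
    calc R.term (I.balanced q.1 * (s * μ'.plan q)) = R.term (s * (I.balanced q.1 * μ'.plan q)) := by
          congr 1; ring
      _ ≤ _ := by linarith
  have hsum := Finset.sum_le_sum fun q' (_ : q' ∈ Finset.univ.erase q) => hconv q'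
  rw [Finset.sum_add_distrib, ← Finset.mul_sum] at hsum
  rw [Finset.sum_add_distrib, Finset.sum_add_distrib,
    ← Finset.add_sum_erase _ (fun q' : I.Pair => R.term (I.balanced q'.1 * μ.plan q') / η)
      (Finset.mem_univ q),
    ← Finset.add_sum_erase _ (fun q' : I.Pair =>
      R.term (I.balanced q'.1 * (μ.plan q' + s * (μ'.plan q' - μ.plan q'))) / η)
      (Finset.mem_univ q)] at h
  have hlin : ∑ q', (μ.plan q' + s * (μ'.plan q' - μ.plan q')) * L q' =
      ∑ q', μ.plan q' * L q' + s * ∑ q', (μ'.plan q' - μ.plan q') * L q' := by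
    rw [Finset.mul_sum, ← Finset.sum_add_distrib]
    exact Finset.sum_congr rfl fun _ _ => by ring
  have hz : R.term (I.balanced q.1 * μ.plan q) / η = 0 := by simp [h0, R.term_zero]
  rw [hlin, hz] at h
  have : s * B = s * ∑ q', (μ'.plan q' - μ.plan q') * L q' +
    s * ∑ q' ∈ Finset.univ.erase q, (R.term (I.balanced q'.1 * μ'.plan q') -
      R.term (I.balanced q'.1 * μ.plan q')) / η := by rw [hB, mul_add]
  linarith

/-- The first-order optimality condition. -/
theorem objective_min_first_order {R : Entropy} {η : ℝ} (hη : 0 < η) {L : I.Pair → ℝ}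
    {μ : I.Policy}
    (hmin : ∀ μ', objective R (fun _ => η) L μ ≤ objective R (fun _ => η) L μ')
    (μ' : I.Policy) :
    0 ≤ ∑ q, ((μ'.plan q - μ.plan q) * L q +
      R.slope (I.balanced q.1 * μ.plan q) *
        (I.balanced q.1 * (μ'.plan q - μ.plan q)) / η) := by
  set φ : ℝ → ℝ := fun s => ∑ q, ((μ.plan q + s * (μ'.plan q - μ.plan q)) * L q +
        R.term (I.balanced q.1 * (μ.plan q + s * (μ'.plan q - μ.plan q))) / η) with hφ
  have hd : HasDerivAt φ (∑ q, ((μ'.plan q - μ.plan q) * L q +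
      R.slope (I.balanced q.1 * μ.plan q) *
        (I.balanced q.1 * (μ'.plan q - μ.plan q)) / η)) 0 := by
    refine HasDerivAt.fun_sum fun q _ => ?_
    have h1 : HasDerivAt (fun s : ℝ => μ.plan q + s * (μ'.plan q - μ.plan q))
        (μ'.plan q - μ.plan q) 0 := by
      simpa using ((hasDerivAt_id (0 : ℝ)).mul_const (μ'.plan q - μ.plan q)).const_add (μ.plan q)
    have h2 := h1.const_mul (I.balanced q.1)
    have hpos : 0 < I.balanced q.1 * μ.plan q :=
      mul_pos (balanced_pos _) (plan_pos_of_objective_min hη hmin q)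
    have h3 : HasDerivAt R.term (R.slope (I.balanced q.1 * μ.plan q))
        (I.balanced q.1 * (μ.plan q + 0 * (μ'.plan q - μ.plan q))) := by
      simpa using R.hasDerivAt_term hpos
    have h4 : HasDerivAt
        (fun s : ℝ => R.term (I.balanced q.1 * (μ.plan q + s * (μ'.plan q - μ.plan q))))
        (R.slope (I.balanced q.1 * μ.plan q) * (I.balanced q.1 * (μ'.plan q - μ.plan q))) 0 :=
      HasDerivAt.comp (h₂ := R.term) (0 : ℝ) h3 h2
    exact (h1.mul_const (L q)).add (h4.div_const η)
  -- Mixtures are policies only for `s` in `[0, 1]`, hence the one-sided derivative.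
  have ht := hd.tendsto_slope_zero_right
  refine ge_of_tendsto ht ?_
  filter_upwards [Ioc_mem_nhdsGT (zero_lt_one' ℝ)] with s hs
  have h := objective_min_le_mix hmin μ' hs.1.le hs.2
  have h0 : φ 0 = ∑ q, (μ.plan q * L q + R.term (I.balanced q.1 * μ.plan q) / η) := by
    simp [hφ]
  rw [zero_add, smul_eq_mul, h0]
  exact mul_nonneg (inv_nonneg.2 hs.1.le) (sub_nonneg.2 h)

/-- The stability term of follow-the-regularized-leader. -/
noncomputable def stabilityTerm (R : Entropy) (μ : I.Policy) (l : I.Pair → ℝ) : ℝ :=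
  ∑ q, R.weight (I.balanced q.1 * μ.plan q) * (l q / I.balanced q.1)

/-- After removing the first-order term, which is nonnegative by optimality, what remains is a sum
over pairs of a Bregman divergence and a linear loss. `Entropy.stability` with `g = η * l / p⋆`
bounds each summand separately, whatever the comparator. -/
theorem objective_min_step {R : Entropy} {η : ℝ} (hη : 0 < η) {L l : I.Pair → ℝ} {μ : I.Policy}
    (hmin : ∀ μ', objective R (fun _ => η) L μ ≤ objective R (fun _ => η) L μ')
    (hl : ∀ q, 0 ≤ l q) (hl1 : ∀ q, μ.plan q * l q ≤ 1) (μ' : I.Policy) :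
    objective R (fun _ => η) L μ + ∑ q, μ.plan q * l q - η * R.curv * stabilityTerm R μ l ≤
      objective R (fun _ => η) L μ' + ∑ q, μ'.plan q * l q := by
  have hfo := objective_min_first_order hη hmin μ'
  have key : ∀ q : I.Pair, -(η * R.curv *
      (R.weight (I.balanced q.1 * μ.plan q) * (l q / I.balanced q.1))) ≤
      (R.term (I.balanced q.1 * μ'.plan q) - R.term (I.balanced q.1 * μ.plan q) -
        R.slope (I.balanced q.1 * μ.plan q) * (I.balanced q.1 * (μ'.plan q - μ.plan q))) / η +
        l q * (μ'.plan q - μ.plan q) := by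
    intro q
    have hb := balanced_pos q.1
    have hp := plan_pos_of_objective_min hη hmin q
    have h := R.stability (mul_pos hb hp) (mul_nonneg hb.le (μ'.plan_nonneg q))
      (g := η * l q / I.balanced q.1) (div_nonneg (mul_nonneg hη.le (hl q)) hb.le)
    have hw := R.weight_nonneg (mul_pos hb hp).le
    have h2 := div_le_div_of_nonneg_right h hη.le
    refine le_trans ?_ (h2.trans (le_of_eq ?_))
    -- The bound is quadratic in `l`. One factor `μ.plan q * l q ≤ 1` is dropped, which leaves the
    -- linear stability term.
    · have e : -(R.curv * R.weight (I.balanced q.1 * μ.plan q) * (I.balanced q.1 * μ.plan q) *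
          (η * l q / I.balanced q.1) ^ 2) / η =
          -(η * R.curv * (R.weight (I.balanced q.1 * μ.plan q) * (l q / I.balanced q.1))) *
            (μ.plan q * l q) := by
        field_simp
      rw [e, neg_mul]
      refine neg_le_neg (mul_le_of_le_one_right ?_ (hl1 q))
      exact mul_nonneg (mul_nonneg hη.le R.curv_pos.le)
        (mul_nonneg hw (div_nonneg (hl q) hb.le))
    · field_simp
  have hsum := Finset.sum_le_sum fun q (_ : q ∈ Finset.univ) => key q
  rw [Finset.sum_neg_distrib, ← Finset.mul_sum] at hsum
  have e : objective R (fun _ => η) L μ' + ∑ q, μ'.plan q * l q -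
      (objective R (fun _ => η) L μ + ∑ q, μ.plan q * l q) =
      ∑ q, ((μ'.plan q - μ.plan q) * L q + R.slope (I.balanced q.1 * μ.plan q) *
        (I.balanced q.1 * (μ'.plan q - μ.plan q)) / η) +
      ∑ q : I.Pair, ((R.term (I.balanced q.1 * μ'.plan q) - R.term (I.balanced q.1 * μ.plan q) -
        R.slope (I.balanced q.1 * μ.plan q) * (I.balanced q.1 * (μ'.plan q - μ.plan q))) / η +
        l q * (μ'.plan q - μ.plan q)) := by
    rw [objective_eq, objective_eq, ← Finset.sum_add_distrib, ← Finset.sum_add_distrib,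
      ← Finset.sum_add_distrib, ← Finset.sum_sub_distrib]
    exact Finset.sum_congr rfl fun q _ => by ring
  unfold stabilityTerm
  linarith

/-- The regret of follow-the-regularized-leader on the treeplex, for nonnegative losses. -/
theorem ftrl_regret_le {R : Entropy} {η : ℝ} (hη : 0 < η) {T : ℕ} (hT : 0 < T) (hH : 0 < H)
    (hA : 0 < I.totalActions) (μ : ℕ → I.Policy) (l : ℕ → I.Pair → ℝ)
    (hmin : ∀ t < T, ∀ μ', objective R (fun _ => η) (∑ k ∈ Finset.range t, l k) (μ t) ≤
      objective R (fun _ => η) (∑ k ∈ Finset.range t, l k) μ')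
    (hl : ∀ t < T, ∀ q, 0 ≤ l t q) (hl1 : ∀ t < T, ∀ q, (μ t).plan q * l t q ≤ 1)
    (μ' : I.Policy) :
    ∑ t ∈ Finset.range T, ∑ q, ((μ t).plan q - μ'.plan q) * l t q ≤
      R.range I.totalActions H / η +
        η * R.curv * ∑ t ∈ Finset.range T, stabilityTerm R (μ t) (l t) := by
  -- The comparator is quantified inside the induction: the step uses the hypothesis at the
  -- minimizer `μ t` to bound the new objective at an arbitrary policy.
  have hind : ∀ t ≤ T, ∀ μ', objective R (fun _ => η) 0 (μ 0) +
      ∑ k ∈ Finset.range t, (∑ q, (μ k).plan q * l k q -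
        η * R.curv * stabilityTerm R (μ k) (l k)) ≤
      objective R (fun _ => η) (∑ k ∈ Finset.range t, l k) μ' := by
    intro t
    induction t with
    | zero => intro _ μ'; simpa using hmin 0 hT μ'
    | succ t ih =>
      intro ht μ'
      have h1 := ih (by omega) (μ t)
      have h2 := objective_min_step hη (hmin t ht) (hl t ht) (hl1 t ht) μ'
      have h3 : objective R (fun _ => η) (∑ k ∈ Finset.range (t + 1), l k) μ' =
          objective R (fun _ => η) (∑ k ∈ Finset.range t, l k) μ' + ∑ q, μ'.plan q * l t q := by
        rw [Finset.sum_range_succ, objective_eq, objective_eq, ← Finset.sum_add_distrib]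
        exact Finset.sum_congr rfl fun q _ => by simp only [Pi.add_apply]; ring
      rw [h3, Finset.sum_range_succ]
      linarith
  have h := hind T le_rfl μ'
  have e : objective R (fun _ => η) (∑ k ∈ Finset.range T, l k) μ' =
      objective R (fun _ => η) 0 μ' + ∑ t ∈ Finset.range T, ∑ q, μ'.plan q * l t q := by
    rw [objective_eq, objective_eq, Finset.sum_comm, ← Finset.sum_add_distrib]
    refine Finset.sum_congr rfl fun q _ => ?_
    simp only [Finset.sum_apply, Finset.mul_sum, Pi.zero_apply]
    ring
  have hpen : objective R (fun _ => η) 0 μ' - objective R (fun _ => η) 0 (μ 0) ≤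
      R.range I.totalActions H / η := by
    rw [objective_eq, objective_eq]
    simp only [Pi.zero_apply, mul_zero, zero_add]
    rw [← Finset.sum_div, ← Finset.sum_div, ← sub_div]
    refine div_le_div_of_nonneg_right (R.sum_term_sub_le hA hH ?_
      (fun q => mul_nonneg (balanced_pos _).le ((μ 0).plan_nonneg q))
      (fun q => mul_nonneg (balanced_pos _).le (μ'.plan_nonneg q))
      (fun q => balanced_mul_plan_le_one μ' q)
      (sum_balanced_mul_plan_le_length (μ 0))) hη.le
    simp [totalActions]
  rw [Finset.sum_sub_distrib, ← Finset.mul_sum] at h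
  simp only [sub_mul, Finset.sum_sub_distrib]
  linarith

end InfoTree

/-! ### Adaptively drawn sequences and Chernoff's bound -/

section SequenceWeight

variable {E : Type*}

/-- The weight of a sequence when each entry is drawn from a kernel that depends on the past. -/
def seqWeight (P : ∀ t : ℕ, (Fin t → E) → E → ℝ) (n : ℕ) (ω : Fin n → E) : ℝ :=
  ∏ t : Fin n, P t (fun i => ω (Fin.castLE t.isLt.le i)) (ω t)

theorem seqWeight_succ (P : ∀ t : ℕ, (Fin t → E) → E → ℝ) (n : ℕ) (ω : Fin (n + 1) → E) :
    seqWeight P (n + 1) ω = seqWeight P n (fun i => ω i.castSucc) *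
      P n (fun i => ω i.castSucc) (ω (Fin.last n)) := by
  rw [seqWeight, Fin.prod_univ_castSucc]
  rfl

theorem seqWeight_snoc (P : ∀ t : ℕ, (Fin t → E) → E → ℝ) (n : ℕ) (ω : Fin n → E) (e : E) :
    seqWeight P (n + 1) (Fin.snoc (α := fun _ => E) ω e) = seqWeight P n ω * P n ω e := by
  simp [seqWeight_succ]

theorem sum_fin_succ_pi [Fintype E] {n : ℕ} (F : (Fin (n + 1) → E) → ℝ) :
    ∑ ω, F ω = ∑ ω : Fin n → E, ∑ e, F (Fin.snoc (α := fun _ => E) ω e) := by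
  rw [← Fintype.sum_equiv (Fin.snocEquiv fun _ => E)
    (fun x => F (Fin.snoc (α := fun _ => E) x.2 x.1)) F (fun _ => rfl), Fintype.sum_prod_type,
    Finset.sum_comm]

theorem seqWeight_nonneg {P : ∀ t : ℕ, (Fin t → E) → E → ℝ} {n : ℕ}
    (h0 : ∀ t < n, ∀ past e, 0 ≤ P t past e) (ω : Fin n → E) : 0 ≤ seqWeight P n ω :=
  Finset.prod_nonneg fun t _ => h0 t t.isLt _ _

/-- Normalization is required only after pasts of nonzero weight: within an episode, the kernel may
fail to be a distribution after states whose depth does not match the time. -/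
theorem sum_seqWeight_eq_one [Fintype E] {P : ∀ t : ℕ, (Fin t → E) → E → ℝ} {n : ℕ}
    (h1 : ∀ t < n, ∀ past, seqWeight P t past ≠ 0 → ∑ e, P t past e = 1) :
    ∑ ω, seqWeight P n ω = 1 := by
  induction n with
  | zero => simp [seqWeight]
  | succ n ih =>
    rw [sum_fin_succ_pi, ← ih fun t ht => h1 t (by omega)]
    refine Finset.sum_congr rfl fun ω _ => ?_
    simp only [seqWeight_snoc, ← Finset.mul_sum]
    by_cases h : seqWeight P n ω = 0
    · simp [h]
    · rw [h1 n (by omega) ω h, mul_one]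

/-- The supermartingale property: it is applied to kernels that have been tilted by an exponential.
-/
theorem sum_seqWeight_le_one [Fintype E] {P : ∀ t : ℕ, (Fin t → E) → E → ℝ} {n : ℕ}
    (h0 : ∀ t < n, ∀ past e, 0 ≤ P t past e) (h1 : ∀ t < n, ∀ past, ∑ e, P t past e ≤ 1) :
    ∑ ω, seqWeight P n ω ≤ 1 := by
  induction n with
  | zero => simp [seqWeight]
  | succ n ih =>
    rw [sum_fin_succ_pi]
    refine le_trans (Finset.sum_le_sum fun ω _ => ?_)
      (ih (fun t ht => h0 t (by omega)) fun t ht => h1 t (by omega))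
    simp only [seqWeight_snoc, ← Finset.mul_sum]
    exact mul_le_of_le_one_right (seqWeight_nonneg (fun t ht => h0 t (by omega)) ω)
      (h1 n (by omega) ω)

/-- Chernoff's bound for finitely many exponential supermartingales at once. -/
theorem sum_indicator_exists_log_lt_le [Fintype E] {ι : Type*} [Fintype ι]
    {P : ∀ t : ℕ, (Fin t → E) → E → ℝ} {n : ℕ} (h0 : ∀ t < n, ∀ past e, 0 ≤ P t past e)
    (s : ι → ∀ t : ℕ, (Fin t → E) → E → ℝ)
    (hs : ∀ i, ∀ t < n, ∀ past, ∑ e, P t past e * Real.exp (s i t past e) ≤ 1)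
    {B : ℝ} (hB : 0 < B) :
    ∑ ω, {ω : Fin n → E | ∃ i, Real.log B <
      ∑ t : Fin n, s i t (fun j => ω (Fin.castLE t.isLt.le j)) (ω t)}.indicator
        (seqWeight P n) ω ≤ Fintype.card ι / B := by
  have hexp : ∀ i, ∀ ω : Fin n → E, seqWeight (fun t past e => P t past e *
      Real.exp (s i t past e)) n ω = seqWeight P n ω *
      Real.exp (∑ t : Fin n, s i t (fun j => ω (Fin.castLE t.isLt.le j)) (ω t)) := by
    intro i ω
    rw [Real.exp_sum, seqWeight, seqWeight, Finset.prod_mul_distrib]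
  -- Markov's inequality and the union bound, stated pointwise.
  have hle : ∀ ω : Fin n → E, {ω : Fin n → E | ∃ i, Real.log B <
      ∑ t : Fin n, s i t (fun j => ω (Fin.castLE t.isLt.le j)) (ω t)}.indicator
        (seqWeight P n) ω ≤ (∑ i, seqWeight (fun t past e => P t past e *
          Real.exp (s i t past e)) n ω) / B := by
    intro ω
    have hw := seqWeight_nonneg h0 ω
    have hnn : ∀ i ∈ Finset.univ, 0 ≤ seqWeight (fun t past e => P t past e *
          Real.exp (s i t past e)) n ω := fun i _ => by
      rw [hexp]; exact mul_nonneg hw (Real.exp_pos _).le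
    by_cases h : ω ∈ {ω : Fin n → E | ∃ i, Real.log B <
      ∑ t : Fin n, s i t (fun j => ω (Fin.castLE t.isLt.le j)) (ω t)}
    · rw [Set.indicator_of_mem h, le_div_iff₀ hB]
      obtain ⟨i, hi⟩ := h
      refine le_trans ?_ (Finset.single_le_sum hnn (Finset.mem_univ i))
      rw [hexp]
      exact mul_le_mul_of_nonneg_left ((Real.log_lt_iff_lt_exp hB).1 hi).le hw
    · rw [Set.indicator_of_notMem h]
      exact div_nonneg (Finset.sum_nonneg hnn) hB.le
  refine (Finset.sum_le_sum fun ω _ => hle ω).trans ?_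
  rw [← Finset.sum_div, Finset.sum_comm]
  refine div_le_div_of_nonneg_right ?_ hB.le
  calc _ ≤ ∑ _i : ι, (1 : ℝ) := Finset.sum_le_sum fun i _ => sum_seqWeight_le_one
        (fun t ht past e => mul_nonneg (h0 t ht past e) (Real.exp_pos _).le) (hs i)
    _ = _ := by simp

end SequenceWeight

/-! ### Implicit-exploration estimates in a single episode -/

namespace InfoTree

variable {H : ℕ} {I : InfoTree.{u} H}

open Classical in
/-- The loss observed at the pair `q`, or `0` if it is not visited. -/
noncomputable def visitLoss (o : I.Obs) (q : I.Pair) : ℝ :=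
  if (o (I.depth q.1)).1 = q then (o (I.depth q.1)).2 else 0

theorem ixLoss_eq (γ : Fin H → ℝ) (μ : I.Policy) (o : I.Obs) (q : I.Pair) :
    ixLoss γ μ o q = visitLoss o q / (μ.plan q + γ (I.depth q.1) / I.balanced q.1) := by
  rw [ixLoss, visitLoss]
  split_ifs <;> simp

open Classical in
/-- At most one pair is visited at each depth. -/
theorem sum_visitLoss_cases (o : I.Obs) (h : Fin H) :
    (∃ q : I.Pair, ∀ w : I.Pair → ℝ,
      ∑ q : I.Pair with I.depth q.1 = h, w q * visitLoss o q = w q * visitLoss o q) ∨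
    ∀ w : I.Pair → ℝ, ∑ q : I.Pair with I.depth q.1 = h, w q * visitLoss o q = 0 := by
  have hz : ∀ q : I.Pair, I.depth q.1 = h → q ≠ (o h).1 → visitLoss o q = 0 := by
    intro q hq hne
    rw [visitLoss, if_neg]
    rw [hq]
    exact fun h => hne h.symm
  by_cases hd : I.depth (o h).1.1 = h
  · refine Or.inl ⟨(o h).1, fun w => ?_⟩
    refine Finset.sum_eq_single_of_mem _ (by simpa using hd) fun q hq hne => ?_
    simp only [Finset.mem_filter, Finset.mem_univ, true_and] at hq
    rw [hz q hq hne, mul_zero]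
  · refine Or.inr fun w => Finset.sum_eq_zero fun q hq => ?_
    simp only [Finset.mem_filter, Finset.mem_univ, true_and] at hq
    rw [hz q hq, mul_zero]
    rintro rfl
    exact hd hq

/-- One episode from the point of view of one player: `p` is the distribution of the outcome, and
`c` is the vector of counterfactual losses, which a flow through the tree dominates. -/
structure IsFeedback {E : Type*} [Fintype E] (obs : E → I.Obs) (p : E → ℝ) (μ : I.Policy)
    (c : I.Pair → ℝ) : Prop where
  prob_nonneg : ∀ e, 0 ≤ p e
  sum_prob : ∑ e, p e = 1
  loss_nonneg : ∀ e h, 0 ≤ (obs e h).2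
  loss_le_one : ∀ e h, (obs e h).2 ≤ 1
  mean : ∀ q, ∑ e, p e * visitLoss (obs e) q = μ.plan q * c q
  nonneg : ∀ q, 0 ≤ c q
  flow : ∃ f, IsFlow f ∧ ∀ q : I.Pair, c q ≤ f q.1

namespace IsFeedback

variable {E : Type*} [Fintype E] {obs : E → I.Obs} {p : E → ℝ} {μ : I.Policy} {c : I.Pair → ℝ}

theorem visitLoss_nonneg (hf : IsFeedback obs p μ c) (e : E) (q : I.Pair) :
    0 ≤ visitLoss (obs e) q := by
  rw [visitLoss]
  split_ifs
  exacts [hf.loss_nonneg _ _, le_rfl]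

theorem visitLoss_le_one (hf : IsFeedback obs p μ c) (e : E) (q : I.Pair) :
    visitLoss (obs e) q ≤ 1 := by
  rw [visitLoss]
  split_ifs
  exacts [hf.loss_le_one _ _, zero_le_one]

theorem sum_div_balanced_le (hf : IsFeedback obs p μ c) :
    ∑ q : I.Pair, c q / I.balanced q.1 ≤ I.totalActions := by
  obtain ⟨f, hf, hc⟩ := hf.flow
  exact (Finset.sum_le_sum fun q _ =>
    div_le_div_of_nonneg_right (hc q) (balanced_pos _).le).trans hf.sum_div_balanced_le

/-- By `mean`, the left side is the expected loss of the episode, and each depth contributes at most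
one visited pair with loss at most `1`. -/
theorem sum_plan_mul_le (hf : IsFeedback obs p μ c) : ∑ q, μ.plan q * c q ≤ H := by
  classical
  simp only [← hf.mean]
  rw [Finset.sum_comm]
  have h1 : ∀ e, ∑ q, p e * visitLoss (obs e) q ≤ p e * H := by
    intro e
    rw [← Finset.mul_sum]
    refine mul_le_mul_of_nonneg_left ?_ (hf.prob_nonneg e)
    rw [sum_pair_eq_sum_depth]
    refine (Finset.sum_le_sum fun h _ => ?_).trans (b := ∑ _h : Fin H, (1 : ℝ)) (by simp)
    rcases sum_visitLoss_cases (obs e) h with ⟨q, hq⟩ | hq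
    · have := hq fun _ => 1
      simp only [one_mul] at this
      refine le_trans (le_of_eq ?_) (this.le.trans (hf.visitLoss_le_one e q))
      congr!
    · have := hq fun _ => 1
      simp only [one_mul] at this
      refine le_trans (le_of_eq ?_) (this.le.trans zero_le_one)
      congr!
  refine (Finset.sum_le_sum fun e _ => h1 e).trans ?_
  rw [← Finset.sum_mul, hf.sum_prob, one_mul]

theorem ixLoss_nonneg (hf : IsFeedback obs p μ c) {γ : ℝ} (hγ : 0 < γ) (e : E) (q : I.Pair) :
    0 ≤ ixLoss (fun _ => γ) μ (obs e) q := by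
  rw [ixLoss_eq]
  exact div_nonneg (hf.visitLoss_nonneg e q)
    (add_nonneg (μ.plan_nonneg q) (div_nonneg hγ.le (balanced_pos _).le))

theorem plan_mul_ixLoss_le_one (hf : IsFeedback obs p μ c) {γ : ℝ} (hγ : 0 < γ) (e : E)
    (q : I.Pair) : μ.plan q * ixLoss (fun _ => γ) μ (obs e) q ≤ 1 := by
  have hb := div_pos hγ (balanced_pos q.1)
  have hp := μ.plan_nonneg q
  rw [ixLoss_eq, ← mul_div_assoc]
  refine div_le_one_of_le₀ ?_ (add_nonneg hp hb.le)
  nlinarith [hf.visitLoss_le_one e q]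

theorem sum_prob_mul_sum (hf : IsFeedback obs p μ c) (s : Finset I.Pair) (w : I.Pair → ℝ) :
    ∑ e, p e * ∑ q ∈ s, w q * visitLoss (obs e) q = ∑ q ∈ s, w q * (μ.plan q * c q) := by
  simp only [← hf.mean, Finset.mul_sum]
  rw [Finset.sum_comm]
  exact Finset.sum_congr rfl fun q _ => Finset.sum_congr rfl fun e _ => by ring

theorem sum_prob_mul_affine (hf : IsFeedback obs p μ c) (K a b : ℝ) (W : E → ℝ) :
    ∑ e, p e * (K * (a + b * W e)) = K * (a + b * ∑ e, p e * W e) := by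
  calc ∑ e, p e * (K * (a + b * W e)) = ∑ e, (K * a * p e + K * b * (p e * W e)) :=
        Finset.sum_congr rfl fun e _ => by ring
    _ = _ := by
        rw [Finset.sum_add_distrib, ← Finset.mul_sum, ← Finset.mul_sum, hf.sum_prob]
        ring

/-- With `z = γ y / (m + γ) < 1`, `exp z ≤ 1 / (1 - z) = (m + γ) / (m + γ - γ y)`, which is at most
`1 + γ y / m` exactly because `y ≤ 1`. The bias `γ` in the denominator absorbs all higher-order
terms of the exponential. -/
theorem exp_ix_le {γ m y : ℝ} (hγ : 0 < γ) (hm : 0 < m) (hy0 : 0 ≤ y) (hy1 : y ≤ 1) :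
    Real.exp (γ * y / (m + γ)) ≤ 1 + γ * y / m := by
  have hmg : 0 < m + γ := by linarith
  have h1 := Real.one_sub_le_exp_neg (γ * y / (m + γ))
  have hy : γ * y ≤ γ := mul_le_of_le_one_right hγ.le hy1
  have h2 : 1 - γ * y / (m + γ) = (m + γ - γ * y) / (m + γ) := by field_simp
  have h3 : 0 < (m + γ - γ * y) / (m + γ) := div_pos (by linarith) hmg
  rw [h2] at h1
  have h4 := inv_anti₀ h3 h1
  rw [Real.exp_neg, inv_inv, inv_div] at h4
  refine h4.trans ?_
  rw [div_le_iff₀ (by linarith)]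
  have h5 : (1 + γ * y / m) * (m + γ - γ * y) = m + γ + γ * (γ * y) * (1 - y) / m := by
    field_simp
    ring
  rw [h5, le_add_iff_nonneg_right]
  exact div_nonneg (mul_nonneg (mul_nonneg hγ.le (mul_nonneg hγ.le hy0)) (sub_nonneg.2 hy1)) hm.le

open Classical in
/-- The implicit-exploration estimate is an optimistic estimate of the loss, in an exponential
sense. -/
theorem sum_prob_mul_exp_upper_le (hf : IsFeedback obs p μ c) {γ : ℝ} (hγ : 0 < γ)
    (hμ : ∀ q, 0 < μ.plan q) {α : I.Pair → ℝ} (hα0 : ∀ q, 0 ≤ α q) (hα1 : ∀ q, α q ≤ 1)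
    (h : Fin H) :
    ∑ e, p e * Real.exp (γ * ∑ q : I.Pair with I.depth q.1 = h,
      α q * ((ixLoss (fun _ => γ) μ (obs e) q - c q) / I.balanced q.1)) ≤ 1 := by
  set S := ∑ q : I.Pair with I.depth q.1 = h, α q * (c q / I.balanced q.1) with hS
  have hone : ∀ e, Real.exp (γ * ∑ q : I.Pair with I.depth q.1 = h,
      α q * ((ixLoss (fun _ => γ) μ (obs e) q - c q) / I.balanced q.1)) ≤
      Real.exp (-(γ * S)) * (1 + ∑ q : I.Pair with I.depth q.1 = h,
        γ * α q / (I.balanced q.1 * μ.plan q) * visitLoss (obs e) q) := by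
    intro e
    -- Clearing p⋆ turns the denominator `μ + γ / p⋆` into `p⋆ μ + γ`, whose bias now equals the
    -- factor of the exponent, as `exp_ix_le` needs.
    have e1 : γ * ∑ q : I.Pair with I.depth q.1 = h,
        α q * ((ixLoss (fun _ => γ) μ (obs e) q - c q) / I.balanced q.1) =
        -(γ * S) + ∑ q : I.Pair with I.depth q.1 = h,
          γ * α q / (I.balanced q.1 * μ.plan q + γ) * visitLoss (obs e) q := by
      rw [hS, Finset.mul_sum, Finset.mul_sum, ← Finset.sum_neg_distrib, ← Finset.sum_add_distrib]
      refine Finset.sum_congr rfl fun q _ => ?_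
      have hb := balanced_pos q.1
      have hm := mul_pos hb (hμ q)
      rw [ixLoss_eq]
      field_simp
      ring
    rw [e1, Real.exp_add]
    refine mul_le_mul_of_nonneg_left ?_ (Real.exp_pos _).le
    -- At most one pair of this depth is visited, so the exponent and its linearization reduce to
    -- the same single term.
    rcases sum_visitLoss_cases (obs e) h with ⟨q, hq⟩ | hq
    · rw [hq, hq]
      have := exp_ix_le hγ (mul_pos (balanced_pos q.1) (hμ q))
        (mul_nonneg (hα0 q) (hf.visitLoss_nonneg e q))
        (mul_le_one₀ (hα1 q) (hf.visitLoss_nonneg e q) (hf.visitLoss_le_one e q))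
      rwa [← mul_assoc, mul_div_right_comm (γ * α q), mul_div_right_comm (γ * α q)] at this
    · rw [hq, hq]
      simp
  calc _ ≤ ∑ e, p e * (Real.exp (-(γ * S)) * (1 + ∑ q : I.Pair with I.depth q.1 = h,
        γ * α q / (I.balanced q.1 * μ.plan q) * visitLoss (obs e) q)) :=
        Finset.sum_le_sum fun e _ => mul_le_mul_of_nonneg_left (hone e) (hf.prob_nonneg e)
    _ = Real.exp (-(γ * S)) * (1 + γ * S) := by
        have e2 : γ * S = ∑ q : I.Pair with I.depth q.1 = h,
            γ * α q / (I.balanced q.1 * μ.plan q) * (μ.plan q * c q) := by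
          rw [hS, Finset.mul_sum]
          refine Finset.sum_congr rfl fun q _ => ?_
          have hb := balanced_pos q.1
          have hm := hμ q
          field_simp
        have e3 := hf.sum_prob_mul_affine (Real.exp (-(γ * S))) 1 1
          fun e => ∑ q : I.Pair with I.depth q.1 = h,
            γ * α q / (I.balanced q.1 * μ.plan q) * visitLoss (obs e) q
        rw [hf.sum_prob_mul_sum, ← e2] at e3
        simpa only [one_mul] using e3
    _ ≤ Real.exp (-(γ * S)) * Real.exp (γ * S) :=
        mul_le_mul_of_nonneg_left (by linarith [Real.add_one_le_exp (γ * S)]) (Real.exp_pos _).le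
    _ = 1 := by rw [← Real.exp_add]; simp

open Classical in
/-- The estimated loss of the player is not much smaller than the actual one, in an exponential
sense. -/
theorem sum_prob_mul_exp_lower_le (hf : IsFeedback obs p μ c) {γ : ℝ} (hγ : 0 < γ) (h : Fin H) :
    ∑ e, p e * Real.exp (γ * ∑ q : I.Pair with I.depth q.1 = h,
        μ.plan q * (c q - ixLoss (fun _ => γ) μ (obs e) q) -
      γ ^ 2 * ∑ q : I.Pair with I.depth q.1 = h, c q / I.balanced q.1 - γ ^ 2) ≤ 1 := by
  set S := ∑ q : I.Pair with I.depth q.1 = h, μ.plan q * c q with hS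
  set D := ∑ q : I.Pair with I.depth q.1 = h, c q / I.balanced q.1 with hD
  set Z : E → ℝ := fun e => ∑ q : I.Pair with I.depth q.1 = h,
    μ.plan q / (μ.plan q + γ / I.balanced q.1) * visitLoss (obs e) q with hZ
  have hden : ∀ q : I.Pair, 0 < μ.plan q + γ / I.balanced q.1 := fun q =>
    add_pos_of_nonneg_of_pos (μ.plan_nonneg q) (div_pos hγ (balanced_pos _))
  have hw : ∀ q : I.Pair, 0 ≤ μ.plan q / (μ.plan q + γ / I.balanced q.1) := fun q =>
    div_nonneg (μ.plan_nonneg q) (hden q).le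
  have hw1 : ∀ q : I.Pair, μ.plan q / (μ.plan q + γ / I.balanced q.1) ≤ 1 := fun q =>
    div_le_one_of_le₀ (le_add_of_nonneg_right (div_pos hγ (balanced_pos _)).le) (hden q).le
  have hZ01 : ∀ e, 0 ≤ Z e ∧ Z e ≤ 1 := by
    intro e
    simp only [hZ]
    rcases sum_visitLoss_cases (obs e) h with ⟨q, hq⟩ | hq
    · rw [hq]
      exact ⟨mul_nonneg (hw q) (hf.visitLoss_nonneg e q),
        mul_le_one₀ (hw1 q) (hf.visitLoss_nonneg e q) (hf.visitLoss_le_one e q)⟩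
    · rw [hq]; simp
  -- The downward bias of the estimate costs at most `γ * ∑ c / p⋆`; this is the first compensator
  -- in the exponent.
  have hmean : S - γ * D ≤ ∑ e, p e * Z e := by
    rw [hf.sum_prob_mul_sum, hS, hD, Finset.mul_sum, ← Finset.sum_sub_distrib]
    refine Finset.sum_le_sum fun q _ => ?_
    have h1 := hden q
    have hb := balanced_pos q.1
    have h2 : μ.plan q * c q - μ.plan q / (μ.plan q + γ / I.balanced q.1) * (μ.plan q * c q) =
        μ.plan q / (μ.plan q + γ / I.balanced q.1) * (γ * (c q / I.balanced q.1)) := by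
      rw [show γ * (c q / I.balanced q.1) =
        (μ.plan q + γ / I.balanced q.1 - μ.plan q) * c q by ring]
      generalize μ.plan q + γ / I.balanced q.1 = d at h1
      field_simp
    have h3 := mul_le_of_le_one_left (mul_nonneg hγ.le (div_nonneg (hf.nonneg q) hb.le)) (hw1 q)
    linarith
  have hone : ∀ e, Real.exp (γ * ∑ q : I.Pair with I.depth q.1 = h,
        μ.plan q * (c q - ixLoss (fun _ => γ) μ (obs e) q) - γ ^ 2 * D - γ ^ 2) ≤
      Real.exp (γ * S - γ ^ 2 * D - γ ^ 2) * (1 - γ * Z e + γ ^ 2) := by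
    intro e
    have e1 : γ * ∑ q : I.Pair with I.depth q.1 = h,
        μ.plan q * (c q - ixLoss (fun _ => γ) μ (obs e) q) - γ ^ 2 * D - γ ^ 2 =
        (γ * S - γ ^ 2 * D - γ ^ 2) + -(γ * Z e) := by
      have : ∑ q : I.Pair with I.depth q.1 = h,
        μ.plan q * (c q - ixLoss (fun _ => γ) μ (obs e) q) = S - Z e := by
        simp only [hS, hZ]
        rw [← Finset.sum_sub_distrib]
        refine Finset.sum_congr rfl fun q _ => ?_
        rw [ixLoss_eq]
        ring
      rw [this]
      ring
    rw [e1, Real.exp_add]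
    refine mul_le_mul_of_nonneg_left ?_ (Real.exp_pos _).le
    -- As `Z` lies in `[0, 1]`, the second-order term is at most `γ ^ 2`, the other compensator.
    have h1 := Entropy.exp_neg_le (mul_nonneg hγ.le (hZ01 e).1)
    have h2 : (γ * Z e) ^ 2 ≤ γ ^ 2 := by
      rw [mul_pow]
      exact mul_le_of_le_one_right (sq_nonneg _) (pow_le_one₀ (hZ01 e).1 (hZ01 e).2)
    linarith
  calc _ ≤ ∑ e, p e * (Real.exp (γ * S - γ ^ 2 * D - γ ^ 2) * (1 - γ * Z e + γ ^ 2)) :=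
        Finset.sum_le_sum fun e _ => mul_le_mul_of_nonneg_left (hone e) (hf.prob_nonneg e)
    _ = Real.exp (γ * S - γ ^ 2 * D - γ ^ 2) * (1 + γ ^ 2 - γ * ∑ e, p e * Z e) := by
        have e3 := hf.sum_prob_mul_affine (Real.exp (γ * S - γ ^ 2 * D - γ ^ 2))
          (1 + γ ^ 2) (-γ) Z
        rw [neg_mul, ← sub_eq_add_neg] at e3
        rw [← e3]
        exact Finset.sum_congr rfl fun e _ => by ring
    _ ≤ Real.exp (γ * S - γ ^ 2 * D - γ ^ 2) * Real.exp (-(γ * S - γ ^ 2 * D - γ ^ 2)) := by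
        refine mul_le_mul_of_nonneg_left ?_ (Real.exp_pos _).le
        have h1 := Real.add_one_le_exp (-(γ * S - γ ^ 2 * D - γ ^ 2))
        have h2 := mul_le_mul_of_nonneg_left hmean hγ.le
        linarith
    _ = 1 := by rw [← Real.exp_add]; simp

end IsFeedback

end InfoTree

/-! ### Tuning of the learning rate -/

/-- The two parts of the regret that depend on the regularizer are of the order
`√(H A T ι)`. -/
theorem Entropy.exists_range_div_rate_add_le (R : Entropy) : ∃ K : ℝ, 0 < K ∧
    ∀ (A H T : ℕ) (ι γ : ℝ), 0 < H → H ≤ A → 0 < T → (A : ℝ) ≤ H * T → 1 ≤ ι → Real.log A ≤ ι →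
      H * ι ≤ A * T → 0 < γ → 2 * A * T * γ ^ 2 = H * ι → 0 < R.rate A H T →
      R.range A H / R.rate A H T + R.rate A H T * R.curv *
        (T * (A * R.meanWeight A H) + 2 * H * ι / γ) ≤ K * √(H * A * T * ι) := by
  -- By the choice of `γ`, this quotient is `√2` times the square root on the right.
  have hγN : ∀ (A H T : ℕ) (ι γ : ℝ), 0 < H → H ≤ A → 0 < T → 1 ≤ ι → 0 < γ →
      2 * A * T * γ ^ 2 = H * ι → H * ι / γ ≤ 2 * √(H * A * T * ι) := by
    intro A H T ι γ hH hHA hT hι hγ hγ2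
    have hA' : (0 : ℝ) < A := by exact_mod_cast hH.trans_le hHA
    have hH' : (0 : ℝ) < H := by exact_mod_cast hH
    have hT' : (0 : ℝ) < T := by exact_mod_cast hT
    have hι0 : 0 < ι := by linarith
    have hN : √(H * A * T * ι) ^ 2 = H * A * T * ι := Real.sq_sqrt (by positivity)
    have hsq : (H * ι / γ) ^ 2 = 2 * (H * A * T * ι) := by
      rw [div_pow, div_eq_iff (by positivity)]
      calc (H * ι) ^ 2 = (H * ι) * (H * ι) := by ring
        _ = (H * ι) * (2 * A * T * γ ^ 2) := by rw [hγ2]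
        _ = _ := by ring
    refine abs_le_of_sq_le_sq' ?_ (by positivity) |>.2
    rw [hsq, mul_pow, hN]
    have : 0 < H * A * T * ι := by positivity
    linarith
  cases R with
  | shannon =>
    refine ⟨9, by norm_num, ?_⟩
    intro A H T ι γ hH hHA hT hAHT hι hlog hHι hγ hγ2 hη
    have hA' : (0 : ℝ) < A := by exact_mod_cast hH.trans_le hHA
    have hH' : (1 : ℝ) ≤ H := by exact_mod_cast hH
    have hT' : (0 : ℝ) < T := by exact_mod_cast hT
    have hι0 : 0 < ι := by linarith
    simp only [rate, range, curv, meanWeight] at hη ⊢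
    set N := √(H * A * T * ι) with hN
    have hN0 : 0 ≤ N := Real.sqrt_nonneg _
    have hN2 : N ^ 2 = H * A * T * ι := Real.sq_sqrt (by positivity)
    have hfrac := Real.sqrt_pos.1 hη
    have hη2 : √(2 * (H : ℝ) * Real.log A / (A * T)) ^ 2 = 2 * (H : ℝ) * Real.log A / (A * T) :=
      Real.sq_sqrt hfrac.le
    set η := √(2 * (H : ℝ) * Real.log A / (A * T)) with hηdef
    have hη3 : η ^ 2 * (A * T) = 2 * H * Real.log A := by
      rw [hη2]; field_simp
    have hlog0 : 0 < Real.log A := by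
      by_contra hneg
      have : 0 < η ^ 2 * (A * T) := by positivity
      nlinarith
    have hA2 : (2 : ℝ) ≤ A := by
      have : 1 < A := by
        by_contra h
        interval_cases A <;> simp at hlog0
      exact_mod_cast this
    have hlog2 : 1 / 2 ≤ Real.log A :=
      le_trans (by linarith [Real.log_two_gt_d9]) (Real.log_le_log two_pos hA2)
    have h1 : H * Real.log A ≤ N * η := by
      refine abs_le_of_sq_le_sq' ?_ (by positivity) |>.2
      calc (H * Real.log A) ^ 2 ≤ 2 * (H * Real.log A) * (H * ι) := by
            nlinarith [mul_nonneg (mul_pos (by positivity : 0 < (H : ℝ) * H) hlog0).le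
              (sub_nonneg.2 hlog), mul_pos (mul_pos (by positivity : 0 < (H : ℝ) * H) hlog0) hι0]
        _ = (N * η) ^ 2 := by
            rw [mul_pow, hN2]
            calc 2 * (H * Real.log A) * (H * ι) = (2 * H * Real.log A) * (H * ι) := by ring
              _ = (η ^ 2 * (A * T)) * (H * ι) := by rw [hη3]
              _ = _ := by ring
    -- A positive Shannon rate forces `A ≥ 2`, so `1 ≤ 2 log A` and the additive `1` is absorbed by
    -- `H log A`.
    have h2 : (H * Real.log A + 1) / η ≤ 3 * N := by
      rw [div_le_iff₀ hη]
      nlinarith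
    have h3 : η * (T * A) ≤ 2 * N := by
      refine abs_le_of_sq_le_sq' ?_ (by positivity) |>.2
      calc (η * (T * A)) ^ 2 = (η ^ 2 * (A * T)) * (T * A) := by ring
        _ = 2 * (H * A * T * Real.log A) := by rw [hη3]; ring
        _ ≤ 2 * (H * A * T * ι) := by gcongr
        _ ≤ (2 * N) ^ 2 := by rw [mul_pow, hN2]; linarith [show 0 < H * A * T * ι by positivity]
    -- Since `log A ≤ ι`, the rate is comparable to `γ`, so the deviation part of the stability
    -- costs only a multiple of `H ι`.
    have h4 : η ≤ 2 * γ := by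
      refine abs_le_of_sq_le_sq' ?_ (by positivity) |>.2
      have : η ^ 2 * (A * T) ≤ (2 * γ) ^ 2 * (A * T) := by
        calc η ^ 2 * (A * T) = 2 * H * Real.log A := hη3
          _ ≤ 2 * H * ι := by gcongr
          _ = _ := by linarith
      exact le_of_mul_le_mul_right this (by positivity)
    have h5 : H * ι ≤ N := by
      refine abs_le_of_sq_le_sq' ?_ hN0 |>.2
      rw [hN2]
      nlinarith [mul_le_mul_of_nonneg_left hHι (by positivity : 0 ≤ H * ι)]
    have h6 : η * (2 * H * ι / γ) ≤ 4 * N := by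
      calc η * (2 * H * ι / γ) ≤ 2 * γ * (2 * H * ι / γ) := by gcongr
        _ = 4 * (H * ι) := by field_simp; ring
        _ ≤ _ := by linarith
    linarith
  | tsallis q =>
    have hq := q.2.1
    have hq1 := q.2.2
    have hqq : 0 < 2 * (q : ℝ) * (1 - q) := mul_pos (by linarith) (sub_pos.2 hq1)
    set s := √(2 * (q : ℝ) * (1 - q)) with hs
    have hs0 : 0 < s := Real.sqrt_pos.2 hqq
    set k := (tsallis q).curv with hk
    have hk0 : 0 < k := curv_pos _
    refine ⟨1 / s + k * (s + 4 * s), by positivity, ?_⟩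
    intro A H T ι γ hH hHA hT hAHT hι hlog hHι hγ hγ2 hη
    have hA' : (0 : ℝ) < A := by exact_mod_cast hH.trans_le hHA
    have hH' : (0 : ℝ) < H := by exact_mod_cast hH
    have hT' : (0 : ℝ) < T := by exact_mod_cast hT
    have hHA' : (H : ℝ) ≤ A := by exact_mod_cast hHA
    have h1 := hγN A H T ι γ hH hHA hT hι hγ hγ2
    simp only [rate, range, meanWeight] at hη ⊢
    have hm : (0 : ℝ) < H / A := div_pos hH' hA'
    have hm1 : (H : ℝ) / A ≤ 1 := div_le_one_of_le₀ hHA' hA'.le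
    set m : ℝ := H / A with hmdef
    rw [Real.sqrt_div hqq.le] at hη ⊢
    set N := √(H * A * T * ι) with hN
    have hN0 : 0 ≤ N := Real.sqrt_nonneg _
    have hsT : 0 < √(T : ℝ) := Real.sqrt_pos.2 hT'
    have hTT : √(T : ℝ) * √T = T := Real.mul_self_sqrt hT'.le
    have hAm : A * √m * √T ≤ N := by
      refine abs_le_of_sq_le_sq' ?_ hN0 |>.2
      rw [Real.sq_sqrt (by positivity), mul_pow, mul_pow, Real.sq_sqrt hm.le,
        Real.sq_sqrt hT'.le]
      calc (A : ℝ) ^ 2 * m * T = H * A * T * 1 := by rw [hmdef]; field_simp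
        _ ≤ _ := by gcongr
    -- The exponent `q - 1/2` balances the two sides: the penalty and the stability both become
    -- multiples of `A √m √T = √(H A T)`.
    have hpos : 0 < m ^ ((q : ℝ) - 1 / 2) := Real.rpow_pos_of_pos hm _
    have e1 : m ^ (q : ℝ) = m ^ ((q : ℝ) - 1 / 2) * √m := by
      rw [Real.sqrt_eq_rpow, ← Real.rpow_add hm]; ring_nf
    have e2 : m ^ ((q : ℝ) - 1 / 2) * m ^ (1 - (q : ℝ)) = √m := by
      rw [Real.sqrt_eq_rpow, ← Real.rpow_add hm]; ring_nf
    have h2 : A * m ^ (q : ℝ) / (s / √T * m ^ ((q : ℝ) - 1 / 2)) ≤ 1 / s * N := by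
      rw [e1]
      calc _ = 1 / s * (A * √m * √T) := by field_simp
        _ ≤ _ := by gcongr
    have h3 : s / √T * m ^ ((q : ℝ) - 1 / 2) * (T * (A * m ^ (1 - (q : ℝ)))) ≤ s * N := by
      calc _ = s / √T * (√T * √T) * A * (m ^ ((q : ℝ) - 1 / 2) * m ^ (1 - (q : ℝ))) := by
            rw [hTT]; ring
        _ = s * (A * √m * √T) := by rw [e2]; field_simp
        _ ≤ _ := by gcongr
    -- For `q < 1/2` this power is large when `H / A` is small; the assumption `A ≤ H T` keeps it
    -- below `√T`.
    have h4 : m ^ ((q : ℝ) - 1 / 2) / √T ≤ 1 := by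
      rw [div_le_one hsT]
      calc m ^ ((q : ℝ) - 1 / 2) ≤ m ^ (-(1 / 2) : ℝ) :=
            Real.rpow_le_rpow_of_exponent_ge hm hm1 (by linarith)
        _ = √(m⁻¹) := by rw [Real.rpow_neg hm.le, ← Real.sqrt_eq_rpow, Real.sqrt_inv]
        _ ≤ √T := by
          refine Real.sqrt_le_sqrt ?_
          rw [hmdef, inv_div, div_le_iff₀ hH']
          linarith
    have h5 : s / √T * m ^ ((q : ℝ) - 1 / 2) * (2 * H * ι / γ) ≤ 4 * s * N := by
      calc s / √T * m ^ ((q : ℝ) - 1 / 2) * (2 * H * ι / γ)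
          = s * (m ^ ((q : ℝ) - 1 / 2) / √T) * (2 * (H * ι / γ)) := by ring
        _ ≤ s * 1 * (2 * (2 * N)) := by gcongr
        _ = _ := by ring
    calc _ = A * m ^ (q : ℝ) / (s / √T * m ^ ((q : ℝ) - 1 / 2)) +
          k * (s / √T * m ^ ((q : ℝ) - 1 / 2) * (T * (A * m ^ (1 - (q : ℝ)))) +
            s / √T * m ^ ((q : ℝ) - 1 / 2) * (2 * H * ι / γ)) := by ring
      _ ≤ 1 / s * N + k * (s * N + 4 * s * N) := by gcongr
      _ = _ := by ring

/-! ### High-probability regret of one player -/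

namespace InfoTree

variable {H : ℕ} {I : InfoTree.{u} H}

/-- The policy of episode `t` when the observations are `o`. -/
abbrev Learner.played (L : I.Learner) {T : ℕ} (o : Fin T → I.Obs) (t : Fin T) : I.Policy :=
  L t fun i => o (Fin.castLE t.isLt.le i)

theorem Learner.IsBalancedFTRL.regret_le {L : I.Learner} {R : Entropy} {η γ : ℝ} {T : ℕ}
    (hL : L.IsBalancedFTRL R (fun _ => η) (fun _ => γ) T) (hη : 0 < η) (hT : 0 < T) (hH : 0 < H)
    (hA : 0 < I.totalActions) (o : Fin T → I.Obs)
    (hl : ∀ t q, 0 ≤ ixLoss (fun _ => γ) (L.played o t) (o t) q)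
    (hl1 : ∀ t q, (L.played o t).plan q * ixLoss (fun _ => γ) (L.played o t) (o t) q ≤ 1)
    (μ' : I.Policy) :
    ∑ t, ∑ q, ((L.played o t).plan q - μ'.plan q) *
        ixLoss (fun _ => γ) (L.played o t) (o t) q ≤
      R.range I.totalActions H / η + η * R.curv *
        ∑ t, stabilityTerm R (L.played o t) (ixLoss (fun _ => γ) (L.played o t) (o t)) := by
  -- The values beyond the horizon are arbitrary defaults.
  set μ : ℕ → I.Policy := fun t => if h : t < T then L.played o ⟨t, h⟩ else I.uniformPolicy
    with hμ
  set l : ℕ → I.Pair → ℝ := fun t => if h : t < T then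
    ixLoss (fun _ => γ) (L.played o ⟨t, h⟩) (o ⟨t, h⟩) else 0 with hldef
  have hμt : ∀ t : Fin T, μ t = L.played o t := fun t => by simp [hμ]
  have hlt : ∀ t : Fin T, l t = ixLoss (fun _ => γ) (L.played o t) (o t) := fun t => by
    simp [hldef]
  have key := ftrl_regret_le (R := R) hη hT hH hA μ l ?_ ?_ ?_ μ'
  · simpa only [Finset.sum_range, hμt, hlt] using key
  · intro t ht μ''
    have h := hL t ht (fun i => o (Fin.castLE ht.le i)) μ''
    have e1 : cumLoss (fun _ => γ) L (fun i : Fin t => o (Fin.castLE ht.le i)) =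
        ∑ k ∈ Finset.range t, l k := by
      funext q
      rw [Finset.sum_apply, Finset.sum_range, cumLoss]
      refine Finset.sum_congr rfl fun k _ => ?_
      rw [show l k = l (Fin.castLE ht.le k) from rfl, hlt]
      rfl
    rw [e1] at h
    rw [show μ t = μ ((⟨t, ht⟩ : Fin T) : ℕ) from rfl, hμt]
    exact h
  · intro t ht q
    rw [show l t = l ((⟨t, ht⟩ : Fin T) : ℕ) from rfl, hlt]
    exact hl _ q
  · intro t ht q
    rw [show l t = l ((⟨t, ht⟩ : Fin T) : ℕ) from rfl, hlt,
      show μ t = μ ((⟨t, ht⟩ : Fin T) : ℕ) from rfl, hμt]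
    exact hl1 _ q

/-- The Shannon rate vanishes when `A = 1`, and division by it would be meaningless. In that case
there is only one realization plan, so the regret is zero. -/
theorem rate_pos_or_plan_eq (R : Entropy) {T : ℕ} (hT : 0 < T) (hH : 0 < H)
    (hA : 0 < I.totalActions) :
    0 < R.rate I.totalActions H T ∨ ∀ (μ : I.Policy) (q : I.Pair), μ.plan q = 1 := by
  have hA' : (0 : ℝ) < I.totalActions := by exact_mod_cast hA
  have hH' : (0 : ℝ) < H := by exact_mod_cast hH
  have hT' : (0 : ℝ) < T := by exact_mod_cast hT
  cases R with
  | shannon =>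
    rcases (Nat.succ_le_of_lt hA).eq_or_lt with h1 | h1
    · right
      have hprob : ∀ (μ : I.Policy) (q : I.Pair), μ.prob q.1 q.2 = 1 := by
        intro μ q
        have hc : Fintype.card (I.Act q.1) ≤ 1 := (Finset.single_le_sum
          (f := fun x : I.Info => Fintype.card (I.Act x)) (fun _ _ => Nat.zero_le _)
          (Finset.mem_univ q.1)).trans h1.symm.le
        have := Fintype.card_le_one_iff_subsingleton.1 hc
        rw [← μ.sum_prob q.1, Fintype.sum_subsingleton _ q.2]
      intro μ q
      rw [μ.plan_eq, hprob, mul_one]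
      generalize q.1 = x
      induction x using info_induction with
      | h x ih =>
        cases hp : I.parent x with
        | none => exact μ.reach_of_none hp
        | some q => rw [μ.reach_of_some hp, μ.plan_eq, hprob, ih q hp, mul_one]
    · left
      have : 0 < Real.log I.totalActions := Real.log_pos (by exact_mod_cast h1)
      exact Real.sqrt_pos.2 (by positivity)
  | tsallis q =>
    left
    have := q.2.1
    have := sub_pos.2 q.2.2
    exact mul_pos (Real.sqrt_pos.2 (by positivity)) (Real.rpow_pos_of_pos (by positivity) _)

/-- The high-probability regret bound of Balanced FTRL against an arbitrary adaptive opponent. -/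
theorem exists_regret_constant (R : Entropy) : ∃ K : ℝ, 0 < K ∧
    ∀ {H : ℕ} {I : InfoTree.{u} H} {E : Type u} [Fintype E] (obs : E → I.Obs)
      (P : ∀ t : ℕ, (Fin t → E) → E → ℝ) (c : ∀ t : ℕ, (Fin t → E) → I.Pair → ℝ)
      (L : I.Learner) (T : ℕ) (δ : ℝ),
      0 < T → 0 < H → H ≤ I.totalActions → 0 < δ → δ < 1 →
      (I.totalActions : ℝ) ≤ H * T →
      H * Real.log (3 * I.totalActions / δ) ≤ I.totalActions * T →
      (∀ t < T, ∀ past : Fin t → E,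
        IsFeedback obs (P t past) (L t fun i => obs (past i)) (c t past)) →
      L.IsTunedBalancedFTRL R T δ →
      ∃ Bad : Set (Fin T → E), ∑ ω, Bad.indicator (seqWeight P T) ω ≤ δ / 2 ∧
        ∀ ω ∉ Bad, ∀ μ' : I.Policy,
          ∑ t : Fin T, ∑ q, ((L.played (fun t => obs (ω t)) t).plan q - μ'.plan q) *
            c t (fun i => ω (Fin.castLE t.isLt.le i)) q ≤
          K * √(H * I.totalActions * T * Real.log (3 * I.totalActions / δ)) := by
  classical
  obtain ⟨K, hK0, hK⟩ := R.exists_range_div_rate_add_le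
  refine ⟨K + 10, by positivity, ?_⟩
  intro H I E _ obs P c L T δ hT hH hHA hδ0 hδ1 hAHT hHι hP hL
  have hA : 0 < I.totalActions := hH.trans_le hHA
  rcases rate_pos_or_plan_eq R hT hH hA with hη | hone
  swap
  · refine ⟨∅, by simpa using (half_pos hδ0).le, fun ω _ μ' => ?_⟩
    simp only [hone, sub_self, zero_mul, Finset.sum_const_zero]
    positivity
  set A := I.totalActions with hAdef
  have hA' : (1 : ℝ) ≤ A := by exact_mod_cast hA
  have hH' : (0 : ℝ) < H := by exact_mod_cast hH
  have hT' : (0 : ℝ) < T := by exact_mod_cast hT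
  have hHA' : (H : ℝ) ≤ A := by exact_mod_cast hHA
  set ι := Real.log (3 * A / δ) with hιdef
  have h3A : 3 * (A : ℝ) ≤ 3 * A / δ := by
    rw [le_div_iff₀ hδ0]
    nlinarith
  have hι1 : 1 ≤ ι := by
    rw [hιdef, Real.le_log_iff_exp_le (by positivity)]
    linarith [Real.exp_one_lt_d9]
  have hι0 : 0 < ι := by linarith
  have hlogA : Real.log A ≤ ι := Real.log_le_log (by linarith) (by linarith)
  -- There are `A + 2H ≤ 3A` deviation events. The threshold `log (6A / δ)` makes their total
  -- probability at most `δ / 2`.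
  have hlogB : Real.log (6 * A / δ) ≤ 2 * ι := by
    rw [show 6 * (A : ℝ) / δ = 2 * (3 * A / δ) by ring, Real.log_mul two_ne_zero (by positivity)]
    linarith [Real.log_two_lt_d9]
  set γ := ixParameter A H T δ with hγdef
  have hγ0 : 0 < γ := Real.sqrt_pos.2 (by positivity)
  have hγ2 : 2 * A * T * γ ^ 2 = H * ι := by
    rw [hγdef, ixParameter, Real.sq_sqrt (by positivity), ← hιdef]
    field_simp
  set η := R.rate A H T with hηdef
  set N := √(H * A * T * ι) with hN
  have hN0 : 0 ≤ N := Real.sqrt_nonneg _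
  have hN2 : N ^ 2 = H * A * T * ι := Real.sq_sqrt (by positivity)
  have hpos : ∀ t < T, ∀ (o : Fin t → I.Obs) (q : I.Pair), 0 < (L t o).plan q :=
    fun t ht o => plan_pos_of_objective_min hη (hL t ht o)
  set μ : ∀ t : ℕ, (Fin t → E) → I.Policy := fun t past => L t fun i => obs (past i) with hμ
  set ix : ∀ t : ℕ, (Fin t → E) → E → I.Pair → ℝ :=
    fun t past e => ixLoss (fun _ => γ) (μ t past) (obs e) with hix
  -- These weights depend on the past only, so they may multiply the increments of a
  -- supermartingale.
  set w : ∀ t : ℕ, (Fin t → E) → I.Pair → ℝ :=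
    fun t past q => R.weight (I.balanced q.1 * (μ t past).plan q) with hw
  have hbp : ∀ (ν : I.Policy) (q : I.Pair), 0 ≤ I.balanced q.1 * ν.plan q := fun ν q =>
    mul_nonneg (balanced_pos _).le (ν.plan_nonneg q)
  -- One process per pair for the competitor's loss, one per depth for the stability term, and one
  -- per depth for the player's own loss.
  set s : I.Pair ⊕ Fin H ⊕ Fin H → ∀ t : ℕ, (Fin t → E) → E → ℝ := Sum.elim
    (fun q₀ t past e => γ * ∑ q : I.Pair with I.depth q.1 = I.depth q₀.1,
      (if q = q₀ then 1 else 0) * ((ix t past e q - c t past q) / I.balanced q.1))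
    (Sum.elim
      (fun h t past e => γ * ∑ q : I.Pair with I.depth q.1 = h,
        w t past q * ((ix t past e q - c t past q) / I.balanced q.1))
      (fun h t past e => γ * ∑ q : I.Pair with I.depth q.1 = h,
          (μ t past).plan q * (c t past q - ix t past e q) -
        γ ^ 2 * ∑ q : I.Pair with I.depth q.1 = h, c t past q / I.balanced q.1 - γ ^ 2)) with hs
  have hs1 : ∀ i, ∀ t < T, ∀ past, ∑ e, P t past e * Real.exp (s i t past e) ≤ 1 := by
    rintro (q₀ | h | h) t ht past
    · refine le_trans (le_of_eq ?_) ((hP t ht past).sum_prob_mul_exp_upper_le hγ0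
        (hpos t ht _) (α := fun q => if q = q₀ then 1 else 0)
        (fun q => by split_ifs <;> norm_num) (fun q => by split_ifs <;> norm_num) (I.depth q₀.1))
      simp only [hs, hix, hμ, Sum.elim_inl]
    · refine le_trans (le_of_eq ?_) ((hP t ht past).sum_prob_mul_exp_upper_le hγ0
        (hpos t ht _) (α := w t past) (fun q => R.weight_nonneg (hbp _ q))
        (fun q => R.weight_le_one (hbp _ q) (balanced_mul_plan_le_one _ q)) h)
      simp only [hs, hix, hμ, Sum.elim_inl, Sum.elim_inr]
    · refine le_trans (le_of_eq ?_) ((hP t ht past).sum_prob_mul_exp_lower_le hγ0 h)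
      simp only [hs, hix, hμ, Sum.elim_inr]
  refine ⟨_, (sum_indicator_exists_log_lt_le (fun t ht past e => (hP t ht past).prob_nonneg e)
    s hs1 (B := 6 * A / δ) (by positivity)).trans ?_, ?_⟩
  · have hc : ((Fintype.card (I.Pair ⊕ Fin H ⊕ Fin H) : ℕ) : ℝ) = A + (H + H) := by
      simp [hAdef, totalActions]
    rw [hc, div_div_eq_mul_div, div_le_iff₀ (by positivity)]
    nlinarith
  intro ω hω μ'
  simp only [Set.mem_ofPred_eq, not_exists, not_lt] at hω
  have hω' := fun i => (hω i).trans hlogB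
  set pst : ∀ t : Fin T, Fin t → E := fun t i => ω (Fin.castLE t.isLt.le i) with hpst
  have hfb := fun t : Fin T => hP t t.isLt (pst t)
  change ∑ t : Fin T, ∑ q, ((μ t (pst t)).plan q - μ'.plan q) * c t (pst t) q ≤ (K + 10) * N
  have hHN : H * ι / γ ≤ 2 * N := by
    refine abs_le_of_sq_le_sq' ?_ (by positivity) |>.2
    rw [div_pow, div_le_iff₀ (by positivity), mul_pow 2 N, hN2]
    calc (H * ι) ^ 2 = (2 * A * T * γ ^ 2) * (H * ι) := by rw [hγ2]; ring
      _ ≤ 2 ^ 2 * (H * A * T * ι) * γ ^ 2 := by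
        linarith [show 0 < (H * A * T * ι) * γ ^ 2 by positivity]
  have hγN : γ * A * T ≤ N := by
    refine abs_le_of_sq_le_sq' ?_ hN0 |>.2
    rw [hN2]
    calc (γ * A * T) ^ 2 = (2 * A * T * γ ^ 2) * (A * T / 2) := by ring
      _ = H * ι * (A * T / 2) := by rw [hγ2]
      _ ≤ _ := by linarith [show 0 < H * A * T * ι by positivity]
  -- the player's own estimated loss
  have hI : ∑ t : Fin T, ∑ q, (μ t (pst t)).plan q *
      (c t (pst t) q - ix t (pst t) (ω t) q) ≤ 6 * N := by
    have h1 : ∑ h : Fin H, ∑ t : Fin T, s (Sum.inr (Sum.inr h)) t (pst t) (ω t) ≤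
        ∑ _h : Fin H, 2 * ι := Finset.sum_le_sum fun h _ => hω' _
    have h2 : ∀ t : Fin T, ∑ h : Fin H, s (Sum.inr (Sum.inr h)) t (pst t) (ω t) =
        γ * ∑ q, (μ t (pst t)).plan q * (c t (pst t) q - ix t (pst t) (ω t) q) -
        γ ^ 2 * ∑ q : I.Pair, c t (pst t) q / I.balanced q.1 - H * γ ^ 2 := by
      intro t
      rw [sum_pair_eq_sum_depth, sum_pair_eq_sum_depth (fun q => c t (pst t) q / I.balanced q.1)]
      simp only [hs, Sum.elim_inr]
      rw [Finset.sum_sub_distrib, Finset.sum_sub_distrib, Finset.mul_sum, Finset.mul_sum]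
      simp
    rw [Finset.sum_comm] at h1
    simp only [h2] at h1
    rw [Finset.sum_sub_distrib, Finset.sum_sub_distrib, ← Finset.mul_sum, ← Finset.mul_sum] at h1
    have h3 : ∑ t : Fin T, ∑ q : I.Pair, c t (pst t) q / I.balanced q.1 ≤ T * A := by
      refine (Finset.sum_le_sum fun t _ => (hfb t).sum_div_balanced_le).trans ?_
      simp [hAdef]
    simp only [Finset.sum_const, Finset.card_univ, Fintype.card_fin, nsmul_eq_mul] at h1
    have h4 : ∑ t : Fin T, ∑ q, (μ t (pst t)).plan q *
      (c t (pst t) q - ix t (pst t) (ω t) q) ≤ γ * A * T + γ * H * T + 2 * (H * ι / γ) := by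
      refine le_of_mul_le_mul_left ?_ hγ0
      have h5 := mul_le_mul_of_nonneg_left h3 (sq_nonneg γ)
      have h6 : γ * (γ * A * T + γ * H * T + 2 * (H * ι / γ)) =
          γ ^ 2 * (T * A) + T * (H * γ ^ 2) + H * (2 * ι) := by field_simp
      rw [h6]
      linarith
    have h7 : γ * H * T ≤ γ * A * T := by gcongr
    linarith
  -- the estimated loss of the competitor
  have hIII : ∑ t : Fin T, ∑ q, μ'.plan q *
      (ix t (pst t) (ω t) q - c t (pst t) q) ≤ 4 * N := by
    -- The competitor may depend on the run, so the deviation is bounded pair by pair; p⋆ then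
    -- recombines these bounds to a factor `H` for every competitor at once.
    have h1 : ∀ q₀ : I.Pair, ∑ t : Fin T, (ix t (pst t) (ω t) q₀ - c t (pst t) q₀) ≤
        I.balanced q₀.1 * (2 * ι / γ) := by
      intro q₀
      have h2 := hω' (Sum.inl q₀)
      simp only [hs, Sum.elim_inl, ite_mul, one_mul, zero_mul, Finset.sum_ite_eq',
        Finset.mem_filter, Finset.mem_univ, true_and, if_true] at h2
      rw [← Finset.mul_sum, ← Finset.sum_div, ← mul_div_assoc,
        div_le_iff₀ (balanced_pos _)] at h2
      rw [← mul_div_assoc, le_div_iff₀ hγ0]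
      linarith
    rw [Finset.sum_comm]
    simp only [← Finset.mul_sum]
    calc ∑ q, μ'.plan q * ∑ t : Fin T, (ix t (pst t) (ω t) q - c t (pst t) q)
        ≤ ∑ q : I.Pair, μ'.plan q * (I.balanced q.1 * (2 * ι / γ)) :=
          Finset.sum_le_sum fun q _ => mul_le_mul_of_nonneg_left (h1 q) (μ'.plan_nonneg q)
      _ = (∑ q : I.Pair, I.balanced q.1 * μ'.plan q) * (2 * ι / γ) := by
          rw [Finset.sum_mul]
          exact Finset.sum_congr rfl fun q _ => by ring
      _ ≤ H * (2 * ι / γ) := by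
          gcongr
          exact sum_balanced_mul_plan_le_length μ'
      _ = 2 * (H * ι / γ) := by ring
      _ ≤ 4 * N := by linarith
  have hstab : ∑ t : Fin T, stabilityTerm R (μ t (pst t)) (ix t (pst t) (ω t)) ≤
      T * (A * R.meanWeight A H) + 2 * H * ι / γ := by
    have h1 : ∑ h : Fin H, ∑ t : Fin T, s (Sum.inr (Sum.inl h)) t (pst t) (ω t) ≤
        ∑ _h : Fin H, 2 * ι := Finset.sum_le_sum fun h _ => hω' _
    have h2 : ∀ t : Fin T, ∑ h : Fin H, s (Sum.inr (Sum.inl h)) t (pst t) (ω t) =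
        γ * (stabilityTerm R (μ t (pst t)) (ix t (pst t) (ω t)) -
          ∑ q : I.Pair, w t (pst t) q * (c t (pst t) q / I.balanced q.1)) := by
      intro t
      rw [stabilityTerm, ← Finset.sum_sub_distrib, sum_pair_eq_sum_depth]
      simp only [hs, Sum.elim_inr, Sum.elim_inl]
      rw [Finset.mul_sum]
      refine Finset.sum_congr rfl fun h _ => ?_
      congr 1
      refine Finset.sum_congr rfl fun q _ => ?_
      simp only [hw]
      ring
    rw [Finset.sum_comm] at h1
    simp only [h2] at h1
    rw [← Finset.mul_sum, Finset.sum_sub_distrib] at h1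
    simp only [Finset.sum_const, Finset.card_univ, Fintype.card_fin, nsmul_eq_mul] at h1
    have h3 : ∑ t : Fin T, ∑ q : I.Pair, w t (pst t) q * (c t (pst t) q / I.balanced q.1) ≤
        T * (A * R.meanWeight A H) := by
      refine (Finset.sum_le_sum fun t _ => R.sum_mul_weight_le hA hH
        (fun q => div_nonneg ((hfb t).nonneg q) (balanced_pos q.1).le) (fun q => hbp _ q)
        (hfb t).sum_div_balanced_le ?_).trans ?_
      · refine le_trans (le_of_eq ?_) (hfb t).sum_plan_mul_le
        refine Finset.sum_congr rfl fun q _ => ?_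
        have := balanced_pos q.1
        field_simp
        rfl
      · simp
    have h4 : ∑ t : Fin T, stabilityTerm R (μ t (pst t)) (ix t (pst t) (ω t)) -
        ∑ t : Fin T, ∑ q : I.Pair, w t (pst t) q * (c t (pst t) q / I.balanced q.1) ≤
        2 * H * ι / γ := by
      rw [le_div_iff₀ hγ0]
      linarith
    linarith
  have hII := Learner.IsBalancedFTRL.regret_le hL hη hT hH hA (fun t => obs (ω t))
    (fun t q => (hfb t).ixLoss_nonneg hγ0 (ω t) q)
    (fun t q => (hfb t).plan_mul_ixLoss_le_one hγ0 (ω t) q) μ'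
  change ∑ t : Fin T, ∑ q, ((μ t (pst t)).plan q - μ'.plan q) * ix t (pst t) (ω t) q ≤
    R.range A H / η + η * R.curv *
      ∑ t : Fin T, stabilityTerm R (μ t (pst t)) (ix t (pst t) (ω t)) at hII
  have hreg := hK A H T ι γ hH hHA hT hAHT hι1 hlogA hHι hγ0 hγ2 hη
  have hII' := mul_le_mul_of_nonneg_left hstab (mul_nonneg hη.le R.curv_pos.le)
  -- The three parts cost `6N`, `K * N` and `4N`.
  have hsplit : ∑ t : Fin T, ∑ q, ((μ t (pst t)).plan q - μ'.plan q) * c t (pst t) q =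
      ∑ t : Fin T, ∑ q, (μ t (pst t)).plan q * (c t (pst t) q - ix t (pst t) (ω t) q) +
      ∑ t : Fin T, ∑ q, ((μ t (pst t)).plan q - μ'.plan q) * ix t (pst t) (ω t) q +
      ∑ t : Fin T, ∑ q, μ'.plan q * (ix t (pst t) (ω t) q - c t (pst t) q) := by
    rw [← Finset.sum_add_distrib, ← Finset.sum_add_distrib]
    refine Finset.sum_congr rfl fun t _ => ?_
    rw [← Finset.sum_add_distrib, ← Finset.sum_add_distrib]
    exact Finset.sum_congr rfl fun q _ => by ring
  rw [hsplit]
  linarith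

end InfoTree

/-! ### Tree size, time averages and the contribution of chance -/

namespace InfoTree

variable {H : ℕ} {I : InfoTree.{u} H}

theorem length_le_totalActions (h : Function.Surjective I.depth) : H ≤ I.totalActions := by
  calc H = Fintype.card (Fin H) := (Fintype.card_fin H).symm
    _ ≤ Fintype.card I.Info := Fintype.card_le_of_surjective _ h
    _ = ∑ _x : I.Info, 1 := by simp
    _ ≤ I.totalActions := Finset.sum_le_sum fun x _ => Nat.succ_le_of_lt Fintype.card_pos

theorem IsTimeAverage.sum_plan_mul {T : ℕ} {μ : Fin T → I.Policy} {μbar : I.Policy}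
    (h : IsTimeAverage μ μbar) (c : I.Pair → ℝ) :
    ∑ q, μbar.plan q * c q = (∑ t, ∑ q, (μ t).plan q * c q) / T := by
  rw [Finset.sum_comm, Finset.sum_div]
  refine Finset.sum_congr rfl fun q _ => ?_
  rw [h q, ← Finset.sum_mul]
  ring

end InfoTree

namespace Game

open InfoTree

variable {H : ℕ} (G : Game.{u} H)

/-- The game with the roles of the two players exchanged. -/
abbrev swap : Game.{u} H where
  State := G.State
  fintypeState := G.fintypeState
  X := G.Y
  Y := G.X
  infoX := G.infoY
  infoY := G.infoX
  infoX_surjective := G.infoY_surjective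
  infoY_surjective := G.infoX_surjective
  depth_eq s := (G.depth_eq s).symm
  init := G.init
  init_nonneg := G.init_nonneg
  sum_init := G.sum_init
  init_depth s hs := by rw [← G.depth_eq]; exact G.init_depth s hs
  trans s b a := G.trans s a b
  trans_nonneg s b a := G.trans_nonneg s a b
  sum_trans s b a hs := G.sum_trans s a b (by rwa [G.depth_eq])
  recallX s b a s' hs := G.recallY s a b s' (by rwa [G.depth_eq])
  recallY s b a s' hs := G.recallX s a b s' (by rwa [G.depth_eq])
  reward s b a := 1 - G.reward s a b
  reward_nonneg s b a := sub_nonneg.2 (G.reward_le_one s a b)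
  reward_le_one s b a := sub_le_self _ (G.reward_nonneg s a b)

/-- The contribution of the dynamics to the probability of arriving at a state at a given step. -/
noncomputable def chance : ℕ → G.State → ℝ
  | 0, s => G.init s
  | h + 1, s' => ∑ s, ∑ a, ∑ b, chance h s * G.trans s a b s'

theorem chance_swap (h : ℕ) (s : G.State) : G.swap.chance h s = G.chance h s := by
  induction h generalizing s with
  | zero => rfl
  | succ h ih =>
    change ∑ s' : G.State, ∑ b, ∑ a, G.swap.chance h s' * G.trans s' a b s =
      ∑ s', ∑ a, ∑ b, G.chance h s' * G.trans s' a b s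
    refine Finset.sum_congr rfl fun s' _ => ?_
    rw [Finset.sum_comm]
    simp only [ih]

variable {G}

theorem chance_nonneg (h : ℕ) (s : G.State) : 0 ≤ G.chance h s := by
  induction h generalizing s with
  | zero => exact G.init_nonneg s
  | succ h ih =>
    exact Finset.sum_nonneg fun s' _ => Finset.sum_nonneg fun a _ => Finset.sum_nonneg fun b _ =>
      mul_nonneg (ih s') (G.trans_nonneg _ _ _ _)

theorem depth_of_chance_ne_zero {h : ℕ} (hh : h < H) {s : G.State} (hs : G.chance h s ≠ 0) :
    (G.X.depth (G.infoX s) : ℕ) = h := by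
  induction h generalizing s with
  | zero => exact G.init_depth s hs
  | succ h ih =>
    obtain ⟨s', _, hs'⟩ := Finset.exists_ne_zero_of_sum_ne_zero hs
    obtain ⟨a, _, ha⟩ := Finset.exists_ne_zero_of_sum_ne_zero hs'
    obtain ⟨b, _, hb⟩ := Finset.exists_ne_zero_of_sum_ne_zero ha
    have hd := ih (by omega) (left_ne_zero_of_mul hb)
    have := G.X.depth_of_parent _ _ (G.recallX s' a b s (by omega) (right_ne_zero_of_mul hb))
    simp only at this
    omega

/-- Perfect recall lets a state carry chance mass only at the time equal to its depth. Sums over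
time thus collapse, and steps can be indexed by states alone. -/
theorem sum_chance (s : G.State) :
    ∑ h : Fin H, G.chance h s = G.chance (G.X.depth (G.infoX s)) s := by
  refine Finset.sum_eq_single_of_mem _ (Finset.mem_univ _) fun h _ hne => ?_
  by_contra hc
  exact hne (Fin.ext (depth_of_chance_ne_zero h.isLt hc).symm)

theorem parentY_eq_none {s : G.State} (h : (G.X.depth (G.infoX s) : ℕ) = 0) :
    G.Y.parent (G.infoY s) = none := by
  rw [G.Y.parent_eq_none_iff, ← G.depth_eq, h]

/-! ### The distribution of an episode -/

/-- The conditional probability of a step, given the previous ones. -/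
def stepProb (μ : G.X.Policy) (ν : G.Y.Policy) : ∀ t : ℕ, (Fin t → G.Step) → G.Step → ℝ
  | 0, _, z => G.init z.1 * (μ.prob (G.infoX z.1) z.2.1 * ν.prob (G.infoY z.1) z.2.2)
  | t + 1, past, z =>
    G.trans (past (Fin.last t)).1 (past (Fin.last t)).2.1 (past (Fin.last t)).2.2 z.1 *
      (μ.prob (G.infoX z.1) z.2.1 * ν.prob (G.infoY z.1) z.2.2)

/-- The sequence lemmas serve on two levels: steps within an episode here, episodes within a run in
`runProb_eq_seqWeight`. -/
theorem episodeProb_eq_seqWeight (μ : G.X.Policy) (ν : G.Y.Policy) (e : G.Episode) :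
    episodeProb μ ν e = seqWeight (stepProb μ ν) H e := by
  rw [episodeProb, seqWeight]
  refine Finset.prod_congr rfl fun h _ => ?_
  obtain ⟨t, ht⟩ := h
  cases t with
  | zero => simp [arrivalProb, stepProb]
  | succ t =>
    simp only [arrivalProb, stepProb, Nat.succ_ne_zero, if_false]
    rfl

theorem stepProb_nonneg (μ : G.X.Policy) (ν : G.Y.Policy) (t : ℕ) (past : Fin t → G.Step)
    (z : G.Step) : 0 ≤ stepProb μ ν t past z := by
  have h := mul_nonneg (μ.prob_nonneg (G.infoX z.1) z.2.1) (ν.prob_nonneg (G.infoY z.1) z.2.2)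
  cases t with
  | zero => exact mul_nonneg (G.init_nonneg _) h
  | succ t => exact mul_nonneg (G.trans_nonneg _ _ _ _) h

/-- Perfect recall raises the depth by one per transition. This supplies the depth condition under
which transitions are normalized. -/
theorem depth_of_seqWeight_ne_zero (μ : G.X.Policy) (ν : G.Y.Policy) {n : ℕ} (hn : n ≤ H)
    (ω : Fin n → G.Step) (hω : seqWeight (stepProb μ ν) n ω ≠ 0) (i : Fin n) :
    (G.X.depth (G.infoX (ω i).1) : ℕ) = i := by
  induction n with
  | zero => exact i.elim0
  | succ n ih =>
    rw [seqWeight_succ] at hω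
    have hi := ih (by omega) _ (left_ne_zero_of_mul hω)
    induction i using Fin.lastCases with
    | cast i => simpa using hi i
    | last =>
      cases n with
      | zero => exact G.init_depth _ (left_ne_zero_of_mul (right_ne_zero_of_mul hω))
      | succ m =>
        have hd := hi (Fin.last m)
        simp only [Fin.val_last] at hd
        have := G.X.depth_of_parent _ _ (G.recallX _ _ _ _ (by rw [hd]; omega)
          (left_ne_zero_of_mul (right_ne_zero_of_mul hω)))
        simp only at this
        rw [this, hd, Fin.val_last]

theorem sum_step_mul (μ : G.X.Policy) (ν : G.Y.Policy) (f : G.State → ℝ) :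
    ∑ z : G.Step, f z.1 * (μ.prob (G.infoX z.1) z.2.1 * ν.prob (G.infoY z.1) z.2.2) =
      ∑ s, f s := by
  rw [Fintype.sum_sigma]
  refine Finset.sum_congr rfl fun s _ => ?_
  rw [Fintype.sum_prod_type]
  simp only [← Finset.mul_sum, ν.sum_prob, mul_one, μ.sum_prob]

theorem sum_stepProb (μ : G.X.Policy) (ν : G.Y.Policy) {n : ℕ} (hn : n < H)
    (ω : Fin n → G.Step) (hω : seqWeight (stepProb μ ν) n ω ≠ 0) :
    ∑ z, stepProb μ ν n ω z = 1 := by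
  cases n with
  | zero =>
    simp only [stepProb]
    rw [sum_step_mul μ ν G.init, G.sum_init]
  | succ m =>
    simp only [stepProb]
    rw [sum_step_mul μ ν, G.sum_trans]
    rw [depth_of_seqWeight_ne_zero μ ν hn.le ω hω, Fin.val_last]
    exact hn

theorem episodeProb_nonneg (μ : G.X.Policy) (ν : G.Y.Policy) (e : G.Episode) :
    0 ≤ episodeProb μ ν e := by
  rw [episodeProb_eq_seqWeight]
  exact seqWeight_nonneg (fun t _ => stepProb_nonneg μ ν t) e

theorem sum_episodeProb (μ : G.X.Policy) (ν : G.Y.Policy) :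
    ∑ e : G.Episode, episodeProb μ ν e = 1 := by
  simp only [episodeProb_eq_seqWeight]
  exact sum_seqWeight_eq_one fun t ht past h => sum_stepProb μ ν ht past h

/-- Episodes have total probability `1`, so one of them has nonzero probability, and it passes
through every depth. Hence `H` is at most the number of actions of either player. -/
theorem exists_depth_eq (h : Fin H) : ∃ s, G.X.depth (G.infoX s) = h := by
  have h1 : ∑ e : G.Episode, episodeProb G.X.uniformPolicy G.Y.uniformPolicy e ≠ 0 := by
    rw [sum_episodeProb]
    exact one_ne_zero
  obtain ⟨e, _, he⟩ := Finset.exists_ne_zero_of_sum_ne_zero h1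
  rw [episodeProb_eq_seqWeight] at he
  exact ⟨(e h).1, Fin.ext (depth_of_seqWeight_ne_zero _ _ le_rfl e he h)⟩

/-- The probability of a step at a given time is the product of the contributions of the two
players and of the dynamics. -/
theorem sum_seqWeight_stepProb_mul (μ : G.X.Policy) (ν : G.Y.Policy) {n : ℕ} (hn : n ≤ H)
    (h : Fin n) (g : G.Step → ℝ) :
    ∑ ω : Fin n → G.Step, seqWeight (stepProb μ ν) n ω * g (ω h) =
      ∑ z : G.Step, μ.plan z.pairX * ν.plan z.pairY * G.chance h z.1 * g z := by
  induction n generalizing g with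
  | zero => exact h.elim0
  | succ n ih =>
    rw [sum_fin_succ_pi]
    simp only [seqWeight_snoc]
    induction h using Fin.lastCases with
    -- The last step is later than `h` and sums out.
    | cast h =>
      simp only [Fin.snoc_castSucc, Fin.val_castSucc]
      rw [← ih (by omega) h g]
      refine Finset.sum_congr rfl fun ω _ => ?_
      rw [← Finset.sum_mul, ← Finset.mul_sum]
      by_cases hω : seqWeight (stepProb μ ν) n ω = 0
      · simp [hω]
      · rw [sum_stepProb μ ν (by omega) ω hω, mul_one]
    | last =>
      simp only [Fin.snoc_last, Fin.val_last]
      cases n with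
      | zero =>
        simp only [Finset.univ_unique, Finset.sum_singleton]
        refine Finset.sum_congr rfl fun z _ => ?_
        simp only [seqWeight, Finset.univ_eq_empty, Finset.prod_empty, one_mul, stepProb, chance]
        by_cases h0 : G.init z.1 = 0
        · simp [h0]
        · have hd := G.init_depth _ h0
          rw [μ.plan_eq, ν.plan_eq,
            show μ.reach z.pairX.1 = 1 from μ.reach_of_none ((G.X.parent_eq_none_iff _).2 hd),
            show ν.reach z.pairY.1 = 1 from ν.reach_of_none (parentY_eq_none hd)]
          simp only [Step.pairX, Step.pairY]
          ring
      | succ m =>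
        simp only [stepProb, mul_assoc]
        simp only [← Finset.mul_sum]
        -- The last transition is absorbed into the test function, which is why the induction
        -- generalizes `g`.
        rw [ih (by omega) (Fin.last m) fun z => ∑ z' : G.Step, G.trans z.1 z.2.1 z.2.2 z'.1 *
          (μ.prob (G.infoX z'.1) z'.2.1 * (ν.prob (G.infoY z'.1) z'.2.2 * g z'))]
        simp only [Finset.mul_sum, Fin.val_last]
        rw [Finset.sum_comm]
        refine Finset.sum_congr rfl fun z' _ => ?_
        rw [chance]
        simp only [Finset.sum_mul, Finset.mul_sum]
        rw [Fintype.sum_sigma]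
        refine Finset.sum_congr rfl fun s _ => ?_
        rw [Fintype.sum_prod_type]
        refine Finset.sum_congr rfl fun a _ => Finset.sum_congr rfl fun b _ => ?_
        simp only
        by_cases hc : G.chance m s = 0
        · simp [hc]
        by_cases ht : G.trans s a b z'.1 = 0
        · simp [ht]
        have hd := depth_of_chance_ne_zero (by omega) hc
        -- By perfect recall, the reach of the new information set is the plan of the preceding
        -- pair, for both players.
        rw [μ.plan_eq z'.pairX, ν.plan_eq z'.pairY,
          show μ.reach z'.pairX.1 = _ from μ.reach_of_some (G.recallX s a b z'.1 (by omega) ht),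
          show ν.reach z'.pairY.1 = _ from ν.reach_of_some (G.recallY s a b z'.1 (by omega) ht)]
        simp only [Step.pairX, Step.pairY]
        ring

theorem sum_episodeProb_mul (μ : G.X.Policy) (ν : G.Y.Policy) (h : Fin H) (g : G.Step → ℝ) :
    ∑ e : G.Episode, episodeProb μ ν e * g (e h) =
      ∑ z : G.Step, μ.plan z.pairX * ν.plan z.pairY * G.chance h z.1 * g z := by
  simp only [episodeProb_eq_seqWeight]
  exact sum_seqWeight_stepProb_mul μ ν le_rfl h g

theorem sum_episodeProb_mul_sum (μ : G.X.Policy) (ν : G.Y.Policy) (g : G.Step → ℝ) :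
    ∑ e : G.Episode, episodeProb μ ν e * ∑ h : Fin H, g (e h) =
      ∑ z : G.Step, μ.plan z.pairX * ν.plan z.pairY *
        G.chance (G.X.depth (G.infoX z.1)) z.1 * g z := by
  simp only [Finset.mul_sum]
  rw [Finset.sum_comm]
  simp only [sum_episodeProb_mul]
  rw [Finset.sum_comm]
  refine Finset.sum_congr rfl fun z _ => ?_
  rw [← sum_chance, ← Finset.sum_mul, ← Finset.mul_sum]

theorem rew_nonneg (z : G.Step) : 0 ≤ z.rew := G.reward_nonneg _ _ _

theorem rew_le_one (z : G.Step) : z.rew ≤ 1 := G.reward_le_one _ _ _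

theorem value_nonneg (μ : G.X.Policy) (ν : G.Y.Policy) : 0 ≤ value μ ν :=
  Finset.sum_nonneg fun e _ => mul_nonneg (episodeProb_nonneg μ ν e)
    (Finset.sum_nonneg fun _ _ => rew_nonneg _)

theorem value_le (μ : G.X.Policy) (ν : G.Y.Policy) : value μ ν ≤ H := by
  calc value μ ν ≤ ∑ e : G.Episode, episodeProb μ ν e * H := by
        refine Finset.sum_le_sum fun e _ =>
          mul_le_mul_of_nonneg_left ?_ (episodeProb_nonneg μ ν e)
        refine (Finset.sum_le_sum fun h _ => rew_le_one (e h)).trans ?_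
        simp
    _ = H := by rw [← Finset.sum_mul, sum_episodeProb, one_mul]

/-! ### Counterfactual losses -/

open Classical in
/-- The counterfactual loss of the max-player, when the min-player uses `ν`. -/
noncomputable def lossX (ν : G.Y.Policy) (q : G.X.Pair) : ℝ :=
  ∑ z : G.Step, if z.pairX = q then ν.plan z.pairY * G.chance (G.X.depth q.1) z.1 * (1 - z.rew)
    else 0

open Classical in
/-- The counterfactual loss of the min-player, when the max-player uses `μ`. -/
noncomputable def lossY (μ : G.X.Policy) (q : G.Y.Pair) : ℝ :=
  ∑ z : G.Step, if z.pairY = q then μ.plan z.pairX * G.chance (G.Y.depth q.1) z.1 * z.rew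
    else 0

/-- Grouping the steps of an episode by the player's pair exhibits the expected loss as linear in
the player's own plan; the constant `H` comes from the losses `1 - r`. -/
theorem sum_plan_mul_lossX (μ : G.X.Policy) (ν : G.Y.Policy) :
    ∑ q, μ.plan q * lossX ν q = H - value μ ν := by
  classical
  have h1 : ∑ q, μ.plan q * lossX ν q = ∑ z : G.Step, μ.plan z.pairX * ν.plan z.pairY *
        G.chance (G.X.depth (G.infoX z.1)) z.1 * (1 - z.rew) := by
    simp only [lossX, Finset.mul_sum]
    rw [Finset.sum_comm]
    refine Finset.sum_congr rfl fun z _ => ?_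
    rw [Finset.sum_eq_single_of_mem z.pairX (Finset.mem_univ _)
      (fun q _ hq => by rw [if_neg hq.symm, mul_zero]), if_pos rfl]
    simp only [Step.pairX]
    ring
  rw [h1, ← sum_episodeProb_mul_sum μ ν fun z => 1 - z.rew, value]
  simp only [Finset.sum_sub_distrib, mul_sub]
  rw [← Finset.sum_mul, sum_episodeProb]
  simp

theorem sum_plan_mul_lossY (μ : G.X.Policy) (ν : G.Y.Policy) :
    ∑ q, ν.plan q * lossY μ q = value μ ν := by
  classical
  rw [value, sum_episodeProb_mul_sum μ ν fun z => z.rew]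
  simp only [lossY, Finset.mul_sum]
  rw [Finset.sum_comm]
  refine Finset.sum_congr rfl fun z _ => ?_
  rw [Finset.sum_eq_single_of_mem z.pairY (Finset.mem_univ _)
    (fun q _ hq => by rw [if_neg hq.symm, mul_zero]), if_pos rfl, G.depth_eq]
  simp only [Step.pairY]
  ring

open Classical in
/-- The contribution of the min-player and of the dynamics to the probability of an information
set of the max-player. -/
noncomputable def flowX (ν : G.Y.Policy) (x : G.X.Info) : ℝ :=
  ∑ s with G.infoX s = x, G.chance (G.X.depth x) s * ν.reach (G.infoY s)

open Classical in
theorem sum_ite_pair_eq (s : G.State) (q : G.X.Pair) (K : ℝ) :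
    ∑ a, (if (⟨G.infoX s, a⟩ : G.X.Pair) = q then K else 0) =
      if G.infoX s = q.1 then K else 0 := by
  obtain ⟨x, a₀⟩ := q
  by_cases h : G.infoX s = x
  · subst h
    simp
  · rw [if_neg h]
    refine Finset.sum_eq_zero fun a _ => if_neg fun h' => h ?_
    exact congrArg Sigma.fst h'

open Classical in
theorem sum_ite_chance_mul_plan (ν : G.Y.Policy) (q : G.X.Pair) :
    ∑ s, ∑ a, ∑ b, (if (⟨G.infoX s, a⟩ : G.X.Pair) = q then
      G.chance (G.X.depth q.1) s * ν.plan ⟨G.infoY s, b⟩ else 0) = flowX ν q.1 := by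
  rw [flowX, Finset.sum_filter]
  refine Finset.sum_congr rfl fun s _ => ?_
  rw [Finset.sum_comm]
  simp only [sum_ite_pair_eq]
  split_ifs
  · rw [← Finset.mul_sum, ν.sum_plan]
  · simp

open Classical in
theorem sum_flowX_filter (ν : G.Y.Policy) (p : G.X.Info → Prop) :
    ∑ x with p x, flowX ν x = ∑ s with p (G.infoX s),
      G.chance (G.X.depth (G.infoX s)) s * ν.reach (G.infoY s) := by
  simp only [flowX]
  rw [Finset.sum_comm' (s' := fun s => {G.infoX s})
    (t' := ({s | p (G.infoX s)} : Finset G.State))]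
  · simp
  · intro x s
    simp only [Finset.mem_filter, Finset.mem_univ, true_and, Finset.mem_singleton]
    constructor
    · rintro ⟨h, rfl⟩
      exact ⟨rfl, h⟩
    · rintro ⟨rfl, h⟩
      exact ⟨h, rfl⟩

/-- Omitting the player's own action probabilities amounts to forcing its action at each pair. Given
`q`, the opponent and chance then pass on at most the mass at `q.1`, since by perfect recall the
children of `q` are entered only through `q`. -/
theorem isFlow_flowX (ν : G.Y.Policy) : IsFlow (flowX ν : G.X.Info → ℝ) := by
  classical
  refine ⟨fun x => Finset.sum_nonneg fun s _ =>
    mul_nonneg (chance_nonneg _ _) (ν.reach_nonneg _), ?_, fun q => ?_⟩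
  · have h := sum_flowX_filter ν fun x => G.X.parent x = none
    refine le_trans (le_of_eq ?_) (h.le.trans ?_)
    · congr!
    · rw [← G.sum_init, Finset.sum_filter]
      refine Finset.sum_le_sum fun s _ => ?_
      split_ifs with hs
      · have hd := (G.X.parent_eq_none_iff _).1 hs
        rw [hd, ν.reach_of_none (parentY_eq_none hd), mul_one, chance]
      · exact G.init_nonneg s
  · have h := sum_flowX_filter ν fun x => G.X.parent x = some q
    refine le_trans (le_of_eq ?_) (h.le.trans ?_)
    · congr!
    · rw [Finset.sum_filter, ← sum_ite_chance_mul_plan]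
      set d := (G.X.depth q.1 : ℕ) with hd
      -- Transitions out of the last depth need not be normalized, but there `q` has no children.
      by_cases hdH : d + 1 < H
      · have h1 : ∀ s', (if G.X.parent (G.infoX s') = some q then
            G.chance (G.X.depth (G.infoX s')) s' * ν.reach (G.infoY s') else 0) ≤
            ∑ s, ∑ a, ∑ b, (if (⟨G.infoX s, a⟩ : G.X.Pair) = q then
              G.chance d s * ν.plan ⟨G.infoY s, b⟩ else 0) * G.trans s a b s' := by
          intro s'
          have hnn : ∀ s a b, 0 ≤ (if (⟨G.infoX s, a⟩ : G.X.Pair) = q then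
              G.chance d s * ν.plan ⟨G.infoY s, b⟩ else 0) * G.trans s a b s' := by
            intro s a b
            refine mul_nonneg ?_ (G.trans_nonneg _ _ _ _)
            split_ifs
            exacts [mul_nonneg (chance_nonneg _ _) (ν.plan_nonneg _), le_rfl]
          split_ifs with hs'
          · rw [G.X.depth_of_parent _ _ hs', ← hd, chance]
            simp only [Finset.sum_mul]
            refine Finset.sum_le_sum fun s _ => Finset.sum_le_sum fun a _ =>
              Finset.sum_le_sum fun b _ => ?_
            by_cases hc : G.chance d s * G.trans s a b s' = 0
            · rw [hc, zero_mul]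
              exact hnn s a b
            · have hds := depth_of_chance_ne_zero (by omega) (left_ne_zero_of_mul hc)
              have hX := G.recallX s a b s' (by omega) (right_ne_zero_of_mul hc)
              have hY := G.recallY s a b s' (by omega) (right_ne_zero_of_mul hc)
              rw [if_pos (Option.some.inj (hX.symm.trans hs')), ν.reach_of_some hY]
              exact (by ring : _ = _).le
          · exact Finset.sum_nonneg fun s _ => Finset.sum_nonneg fun a _ =>
              Finset.sum_nonneg fun b _ => hnn s a b
        refine le_trans (le_of_eq (by congr!))
          ((Finset.sum_le_sum fun s' _ => h1 s').trans (le_of_eq ?_))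
        rw [Finset.sum_comm]
        refine Finset.sum_congr rfl fun s _ => ?_
        rw [Finset.sum_comm]
        refine Finset.sum_congr rfl fun a _ => ?_
        rw [Finset.sum_comm]
        refine Finset.sum_congr rfl fun b _ => ?_
        rw [← Finset.mul_sum]
        by_cases hc : G.chance d s = 0
        · simp [hc]
        · rw [G.sum_trans, mul_one]
          rwa [depth_of_chance_ne_zero (by omega) hc]
      · rw [sum_ite_chance_mul_plan]
        refine le_trans (le_of_eq (Finset.sum_eq_zero fun s' _ => if_neg fun hs' => ?_))
          (Finset.sum_nonneg fun s _ => mul_nonneg (chance_nonneg _ _) (ν.reach_nonneg _))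
        have h1 := G.X.depth_of_parent _ _ hs'
        have h2 := (G.X.depth (G.infoX s')).isLt
        omega

theorem lossX_le (ν : G.Y.Policy) (q : G.X.Pair) : lossX ν q ≤ flowX ν q.1 := by
  classical
  rw [lossX, ← sum_ite_chance_mul_plan, Fintype.sum_sigma]
  refine Finset.sum_le_sum fun s _ => ?_
  rw [Fintype.sum_prod_type]
  refine Finset.sum_le_sum fun a _ => Finset.sum_le_sum fun b _ => ?_
  by_cases h : Step.pairX ⟨s, a, b⟩ = q
  · have h' : (⟨G.infoX s, a⟩ : G.X.Pair) = q := h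
    rw [if_pos h, if_pos h', mul_comm (ν.plan _)]
    exact mul_le_of_le_one_right (mul_nonneg (chance_nonneg _ _) (ν.plan_nonneg _))
      (sub_le_self _ (rew_nonneg _))
  · have h' : (⟨G.infoX s, a⟩ : G.X.Pair) ≠ q := h
    rw [if_neg h, if_neg h']

/-- The dominating flow is that of the game with exchanged roles, whose chance weights agree with
the original ones by `chance_swap`. -/
theorem lossY_le (μ : G.X.Policy) (q : G.Y.Pair) :
    lossY μ q ≤ flowX (G := G.swap) μ q.1 := by
  classical
  refine le_trans ?_ (sum_ite_chance_mul_plan (G := G.swap) μ q).le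
  rw [lossY, Fintype.sum_sigma]
  refine Finset.sum_le_sum fun s _ => ?_
  rw [Fintype.sum_prod_type, Finset.sum_comm]
  refine Finset.sum_le_sum fun b _ => Finset.sum_le_sum fun a _ => ?_
  rw [chance_swap]
  change (if (⟨G.infoY s, b⟩ : G.Y.Pair) = q then _ else _) ≤
    if (⟨G.infoY s, b⟩ : G.Y.Pair) = q then
      G.chance (G.Y.depth q.1) s * μ.plan ⟨G.infoX s, a⟩ else 0
  by_cases h : (⟨G.infoY s, b⟩ : G.Y.Pair) = q
  · rw [if_pos h, if_pos h, mul_comm (μ.plan _)]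
    exact mul_le_of_le_one_right (mul_nonneg (chance_nonneg _ _) (μ.plan_nonneg _))
      (rew_le_one _)
  · rw [if_neg h, if_neg h]

theorem isFeedback_obsX (μ : G.X.Policy) (ν : G.Y.Policy) :
    IsFeedback obsX (episodeProb μ ν) μ (lossX ν) where
  prob_nonneg := episodeProb_nonneg μ ν
  sum_prob := sum_episodeProb μ ν
  loss_nonneg e h := sub_nonneg.2 (rew_le_one _)
  loss_le_one e h := sub_le_self _ (rew_nonneg _)
  mean q := by
    classical
    have h := sum_episodeProb_mul μ ν (G.X.depth q.1)
      fun z => if z.pairX = q then 1 - z.rew else 0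
    refine Eq.trans ?_ (h.trans ?_)
    · refine Finset.sum_congr rfl fun e _ => ?_
      simp only [visitLoss, obsX]
      congr!
    · rw [lossX, Finset.mul_sum]
      refine Finset.sum_congr rfl fun z _ => ?_
      split_ifs with hz
      · rw [hz]; ring
      · simp
  nonneg q := Finset.sum_nonneg fun z _ => by
    split_ifs
    exacts [mul_nonneg (mul_nonneg (ν.plan_nonneg _) (chance_nonneg _ _))
      (sub_nonneg.2 (rew_le_one _)), le_rfl]
  flow := ⟨_, isFlow_flowX ν, lossX_le ν⟩

theorem isFeedback_obsY (μ : G.X.Policy) (ν : G.Y.Policy) :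
    IsFeedback obsY (episodeProb μ ν) ν (lossY μ) where
  prob_nonneg := episodeProb_nonneg μ ν
  sum_prob := sum_episodeProb μ ν
  loss_nonneg e h := rew_nonneg _
  loss_le_one e h := rew_le_one _
  mean q := by
    classical
    have h := sum_episodeProb_mul μ ν (G.Y.depth q.1)
      fun z => if z.pairY = q then z.rew else 0
    refine Eq.trans ?_ (h.trans ?_)
    · refine Finset.sum_congr rfl fun e _ => ?_
      simp only [visitLoss, obsY]
      congr!
    · rw [lossY, Finset.mul_sum]
      refine Finset.sum_congr rfl fun z _ => ?_
      split_ifs with hz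
      · rw [hz]; ring
      · simp
  nonneg q := Finset.sum_nonneg fun z _ => by
    split_ifs
    exacts [mul_nonneg (mul_nonneg (μ.plan_nonneg _) (chance_nonneg _ _)) (rew_nonneg _), le_rfl]
  flow := ⟨_, isFlow_flowX (G := G.swap) μ, lossY_le μ⟩

/-! ### From regret to approximate equilibria -/

/-- The gap of a time-averaged profile is the average regret of the two players. -/
theorem gap_eq_sum_regret {T : ℕ} (hT : 0 < T) {μ : Fin T → G.X.Policy} {ν : Fin T → G.Y.Policy}
    {μbar : G.X.Policy} {νbar : G.Y.Policy} (hμ : IsTimeAverage μ μbar)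
    (hν : IsTimeAverage ν νbar) (μ' : G.X.Policy) (ν' : G.Y.Policy) :
    (value μ' νbar - value μbar ν') * T =
      ∑ t, ∑ q, ((μ t).plan q - μ'.plan q) * lossX (ν t) q +
      ∑ t, ∑ q, ((ν t).plan q - ν'.plan q) * lossY (μ t) q := by
  have hT' : (T : ℝ) ≠ 0 := by positivity
  have h1 : value μ' νbar * T = ∑ t, value μ' (ν t) := by
    rw [← sum_plan_mul_lossY, hν.sum_plan_mul, div_mul_cancel₀ _ hT']
    simp only [sum_plan_mul_lossY]
  have h2 : value μbar ν' * T = ∑ t, value (μ t) ν' := by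
    have h := hμ.sum_plan_mul (lossX ν')
    simp only [sum_plan_mul_lossX, Finset.sum_sub_distrib] at h
    rw [eq_div_iff hT'] at h
    simp only [Finset.sum_const, Finset.card_univ, Fintype.card_fin, nsmul_eq_mul] at h
    linarith
  simp only [sub_mul, Finset.sum_sub_distrib, sum_plan_mul_lossX, sum_plan_mul_lossY]
  rw [h1, h2]
  ring

theorem runProb_eq_seqWeight {T : ℕ} (LX : G.X.Learner) (LY : G.Y.Learner)
    (ω : Fin T → G.Episode) :
    runProb LX LY ω = seqWeight (fun t (past : Fin t → G.Episode) =>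
      episodeProb (LX t fun i => obsX (past i)) (LY t fun i => obsY (past i))) T ω := rfl

theorem one_sub_le_eventProb {T : ℕ} (LX : G.X.Learner) (LY : G.Y.Learner) {δ : ℝ}
    {E B B' : Set (Fin T → G.Episode)} (hE : ∀ ω, ω ∉ B → ω ∉ B' → ω ∈ E)
    (hB : ∑ ω, B.indicator (runProb LX LY) ω ≤ δ / 2)
    (hB' : ∑ ω, B'.indicator (runProb LX LY) ω ≤ δ / 2) :
    1 - δ ≤ eventProb LX LY E := by
  have h1 : ∑ ω : Fin T → G.Episode, runProb LX LY ω = 1 := by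
    simp only [runProb_eq_seqWeight]
    exact sum_seqWeight_eq_one fun t _ past _ => sum_episodeProb _ _
  have h2 : ∑ ω : Fin T → G.Episode, runProb LX LY ω ≤ ∑ ω, (E.indicator (runProb LX LY) ω +
      (B.indicator (runProb LX LY) ω + B'.indicator (runProb LX LY) ω)) := by
    refine Finset.sum_le_sum fun ω _ => ?_
    have h0 : 0 ≤ runProb LX LY ω := Finset.prod_nonneg fun t _ => episodeProb_nonneg _ _ _
    have hi : ∀ S : Set (Fin T → G.Episode), 0 ≤ S.indicator (runProb LX LY) ω := fun S =>
      Set.indicator_apply_nonneg fun _ => h0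
    by_cases hb : ω ∈ B
    · rw [Set.indicator_of_mem hb]
      linarith [hi E, hi B']
    by_cases hb' : ω ∈ B'
    · rw [Set.indicator_of_mem hb']
      linarith [hi E, hi B]
    rw [Set.indicator_of_mem (hE ω hb hb')]
    linarith [hi B, hi B']
  rw [Finset.sum_add_distrib, Finset.sum_add_distrib, h1] at h2
  rw [eventProb]
  linarith

end Game

/-! ### Sample size and conclusion -/

/-- The number of episodes is large enough for one player. -/
theorem sample_size_bounds {K C ε δ S : ℝ} {A H T : ℕ} (hC3 : 3 ≤ C)
    (hCK : 12 * K ^ 2 ≤ C) (hH : 0 < H) (hHA : H ≤ A) (hAS : (A : ℝ) ≤ S) (hS : 2 ≤ S)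
    (hε : 0 < ε) (hεH : ε ≤ H) (hδ : 0 < δ) (hδ1 : δ < 1)
    (hT : C * ((H : ℝ) * S * Real.log (1 / δ + S) / ε ^ 2) ≤ T) :
    (A : ℝ) ≤ H * T ∧ H * Real.log (3 * A / δ) ≤ A * T ∧
      K * √(H * A * T * Real.log (3 * A / δ)) ≤ ε * T / 2 := by
  have hH' : (0 : ℝ) < H := by exact_mod_cast hH
  have hHA' : (H : ℝ) ≤ A := by exact_mod_cast hHA
  have hA' : (0 : ℝ) < A := hH'.trans_le hHA'
  have hS0 : 0 < S := by linarith
  have hδinv : 1 ≤ 1 / δ := by rw [le_div_iff₀ hδ]; linarith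
  set s := 1 / δ + S with hs
  have hs3 : 3 ≤ s := by linarith
  set l := Real.log s with hl
  have hl1 : 1 ≤ l := by
    rw [hl, Real.le_log_iff_exp_le (by linarith)]
    linarith [Real.exp_one_lt_d9]
  -- Each of the factors `3`, `A` and `1 / δ` is at most `s`.
  have hι : Real.log (3 * A / δ) ≤ 3 * l := by
    have h1 : 3 * (A : ℝ) / δ ≤ s ^ 3 := by
      calc 3 * (A : ℝ) / δ = 3 * A * (1 / δ) := by ring
        _ ≤ s * s * s := by gcongr <;> linarith
        _ = s ^ 3 := by ring
    calc Real.log (3 * A / δ) ≤ Real.log (s ^ 3) := Real.log_le_log (by positivity) h1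
      _ = 3 * l := by rw [Real.log_pow, ← hl]; norm_num
  have hT1 : C * (H * S * l) ≤ T * ε ^ 2 := by
    rw [← mul_div_assoc, div_le_iff₀ (by positivity)] at hT
    exact hT
  have hT0 : (0 : ℝ) ≤ T := by positivity
  -- The assumption `ε ≤ H` enters here; both side conditions on `T` follow from this bound.
  have hT2 : C * (S * l) ≤ H * T := by
    have h1 : T * ε ^ 2 ≤ T * (H : ℝ) ^ 2 := by gcongr
    refine le_of_mul_le_mul_left ?_ hH'
    linarith
  have hSl : S ≤ S * l := le_mul_of_one_le_right hS0.le hl1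
  have hT3 : 3 * (S * l) ≤ H * T :=
    (mul_le_mul_of_nonneg_right hC3 (by positivity)).trans hT2
  refine ⟨by linarith, ?_, ?_⟩
  · calc H * Real.log (3 * A / δ) ≤ S * (3 * l) :=
          (mul_le_mul_of_nonneg_left hι hH'.le).trans (by gcongr; linarith)
      _ = 3 * (S * l) := by ring
      _ ≤ H * T := hT3
      _ ≤ A * T := by gcongr
  · refine abs_le_of_sq_le_sq' ?_ (by positivity) |>.2
    have hlog0 : 0 ≤ Real.log (3 * A / δ) := by
      refine Real.log_nonneg ?_
      have : (1 : ℝ) ≤ A := by exact_mod_cast hH.trans_le hHA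
      rw [le_div_iff₀ hδ]
      linarith
    rw [mul_pow, Real.sq_sqrt (by positivity)]
    -- The `12` in the condition on `C` is `3` from `hι` times `4` from halving `ε` between the
    -- players.
    calc K ^ 2 * (H * A * T * Real.log (3 * A / δ)) ≤ K ^ 2 * (H * S * T * (3 * l)) := by
          gcongr
      _ = 12 * K ^ 2 * (H * S * l) * T / 4 := by ring
      _ ≤ C * (H * S * l) * T / 4 := by gcongr
      _ ≤ T * ε ^ 2 * T / 4 := by gcongr
      _ = (ε * T / 2) ^ 2 := by ring

theorem corollary4 (RX RY : Entropy) :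
    ∃ C : ℝ, 0 < C ∧ ∀ (H : ℕ) (G : Game.{u} H) (ε δ : ℝ) (T : ℕ)
      (LX : G.X.Learner) (LY : G.Y.Learner),
      0 < ε → 0 < δ → δ < 1 →
      LX.IsTunedBalancedFTRL RX T δ → LY.IsTunedBalancedFTRL RY T δ →
      C * ((H : ℝ) * ((G.X.totalActions : ℝ) + G.Y.totalActions) *
        Real.log (1 / δ + G.X.totalActions + G.Y.totalActions) / ε ^ 2) ≤ (T : ℝ) →
      1 - δ ≤ Game.eventProb (T := T) LX LY {ω |
        (∃ μbar, InfoTree.IsTimeAverage (Game.policyX LX ω) μbar) ∧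
        (∃ νbar, InfoTree.IsTimeAverage (Game.policyY LY ω) νbar) ∧
        ∀ (μbar : G.X.Policy) (νbar : G.Y.Policy),
          InfoTree.IsTimeAverage (Game.policyX LX ω) μbar →
          InfoTree.IsTimeAverage (Game.policyY LY ω) νbar →
          Game.IsEpsOptimal ε μbar νbar} := by
  obtain ⟨KX, hKX0, hKX⟩ := InfoTree.exists_regret_constant.{u} RX
  obtain ⟨KY, hKY0, hKY⟩ := InfoTree.exists_regret_constant.{u} RY
  -- The `3` secures the side conditions on `T`, the other two summands the regret of each player.
  refine ⟨3 + 12 * KX ^ 2 + 12 * KY ^ 2, by positivity, ?_⟩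
  intro H G ε δ T LX LY hε hδ0 hδ1 hLX hLY hT
  have hne : ∃ s, G.init s ≠ 0 := by
    by_contra! h
    have := G.sum_init
    simp [h] at this
  obtain ⟨s₀, hs₀⟩ := hne
  have hH : 0 < H := (G.X.depth (G.infoX s₀)).pos
  have hHX : H ≤ G.X.totalActions := InfoTree.length_le_totalActions fun h => by
    obtain ⟨s, hs⟩ := Game.exists_depth_eq (G := G) h
    exact ⟨_, hs⟩
  have hHY : H ≤ G.Y.totalActions := InfoTree.length_le_totalActions fun h => by
    obtain ⟨s, hs⟩ := Game.exists_depth_eq (G := G) h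
    exact ⟨_, (G.depth_eq s).symm.trans hs⟩
  have hA1 : (1 : ℝ) ≤ G.X.totalActions := by exact_mod_cast hH.trans_le hHX
  have hB1 : (1 : ℝ) ≤ G.Y.totalActions := by exact_mod_cast hH.trans_le hHY
  have hH' : (0 : ℝ) < H := by exact_mod_cast hH
  rw [add_assoc (1 / δ)] at hT
  have hT0 : 0 < T := by
    have h1 : 0 < Real.log (1 / δ + ((G.X.totalActions : ℝ) + G.Y.totalActions)) :=
      Real.log_pos (by linarith [one_div_pos.2 hδ0])
    have h2 : (0 : ℝ) < T := lt_of_lt_of_le (by positivity) hT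
    exact_mod_cast h2
  -- Values lie in `[0, H]`, so for `ε > H` every profile is `ε`-optimal.
  rcases le_or_gt ε H with hεH | hεH
  · obtain ⟨hX1, hX2, hX3⟩ := sample_size_bounds (K := KX)
      (by linarith [sq_nonneg KX, sq_nonneg KY]) (by linarith [sq_nonneg KY]) hH hHX
      (by linarith) (by linarith) hε hεH hδ0 hδ1 hT
    obtain ⟨hY1, hY2, hY3⟩ := sample_size_bounds (K := KY)
      (by linarith [sq_nonneg KX, sq_nonneg KY]) (by linarith [sq_nonneg KX]) hH hHY
      (by linarith) (by linarith) hε hεH hδ0 hδ1 hT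
    set P : ∀ t : ℕ, (Fin t → G.Episode) → G.Episode → ℝ := fun t past =>
      Game.episodeProb (LX t fun i => Game.obsX (past i)) (LY t fun i => Game.obsY (past i))
    obtain ⟨BX, hBX, hregX⟩ := hKX Game.obsX P
      (fun t past => Game.lossX (LY t fun i => Game.obsY (past i))) LX T δ hT0 hH hHX hδ0 hδ1
      hX1 hX2 (fun t _ past => Game.isFeedback_obsX _ _) hLX
    obtain ⟨BY, hBY, hregY⟩ := hKY Game.obsY P
      (fun t past => Game.lossY (LX t fun i => Game.obsX (past i))) LY T δ hT0 hH hHY hδ0 hδ1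
      hY1 hY2 (fun t _ past => Game.isFeedback_obsY _ _) hLY
    refine Game.one_sub_le_eventProb LX LY (fun ω hωX hωY => ?_) hBX hBY
    refine ⟨InfoTree.exists_isTimeAverage hT0 _, InfoTree.exists_isTimeAverage hT0 _,
      fun μbar νbar hμ hν μ' ν' => ?_⟩
    have hgap := Game.gap_eq_sum_regret hT0 hμ hν μ' ν'
    have h1 := (hregX ω hωX μ').trans hX3
    have h2 := (hregY ω hωY ν').trans hY3
    refine le_of_mul_le_mul_right ?_ (show (0 : ℝ) < T by exact_mod_cast hT0)
    rw [hgap]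
    calc _ ≤ ε * T / 2 + ε * T / 2 := add_le_add h1 h2
      _ = ε * T := by ring
  · refine Game.one_sub_le_eventProb LX LY (B := ∅) (B' := ∅) (fun ω _ _ => ?_)
      (by simpa using (half_pos hδ0).le) (by simpa using (half_pos hδ0).le)
    refine ⟨InfoTree.exists_isTimeAverage hT0 _, InfoTree.exists_isTimeAverage hT0 _,
      fun μbar νbar _ _ μ' ν' => ?_⟩
    linarith [Game.value_le μ' νbar, Game.value_nonneg μbar ν']
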